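/- For $\rho>0$ let $D_\rho=\{z\in\mathbb C:|z|<\rho\}$, let $\mathcal O(D_\rho)$ be the algebra of holomorphic functions on $D_\rho$, and write a series $\hat u\in\mathcal O(D_\rho)[[t]]$ as $$\hat u(t,z)=\sum_{j\ge0}\hat u_{j,*}(z)\frac{t^j}{j!}=\sum_{n\ge0}\hat u_{*,n}(t)\frac{z^n}{n!}.$$ By a sector we mean an open sector of the $t$-plane with vertex $0$ and finite positive radius; a sector $\Sigma$ is a proper subsector of a sector $\Sigma'$ if the closure of $\Sigma$ in $\mathbb C$ is contained in $\Sigma'\cup\{0\}$. A series $\hat u\in\mathcal O(D_\rho)[[t]]$ is called $1$-summable in the direction $\arg t=\theta$ if there exist a sector $\Sigma_\theta$ bisected by $\theta$ with opening larger than $\pi$, a radius $0<r\le\rho$ and a function $u(t,z)$ (a $1$-sum of $\hat u$ in the direction $\theta$) such that: (1) $u$ is holomorphic on $\Sigma_\theta\times D_r$; (2) for each $z\in D_r$, $t\mapsto u(t,z)$ has $\hat u(t,z)$ as Taylor series at $0$ on $\Sigma_\theta$, i.e. $\partial_t^\ell u(t,z)\to\hat u_{\ell,*}(z)$ as $t\to0$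 in any proper subsector of $\Sigma_\theta$, for every $\ell\ge0$; (3) for every proper subsector $\Sigma$ of $\Sigma_\theta$ there are constants $C,K>0$ such that $|\partial_t^\ell u(t,z)|\le CK^\ell\,\Gamma(1+2\ell)$ for all $\ell\ge0$, $t\in\Sigma$, $z\in D_r$. The $1$-summability of a series in $\mathbb C[[t]]$ is defined in the same way, without the parameter $z$. (Restricting the sector, one may and does take its opening to be at most $2\pi$.) Theorem. Let $\rho>0$, let $\theta$ be a direction, and let $a\in\mathcal O(D_\rho)$ and $\hat f\in\mathcal O(D_\rho)[[t]]$. Let $D=1-a(z)\,\partial_t^{-1}\partial_z^2$, where $\partial_t^{-1}$ is the antiderivative with respect to $t$ that vanishes at $t=0$. Assume that either $a(0)\ne0$, or $a(0)=0$ and $a'(0)\neq0$. Then the equation $D\hat u=\hat f$ has a unique solution $\hat u\in\mathcal O(D_\rho)[[t]]$, and $\hat u$ is $1$-summable in the direction $\theta$ if and only if $\hat u_{*,0}(t)$, $\hat u_{*,1}(t)$ and $\hat f(t,z)$ are all $1$-summable in the direction $\theta$. Moreover, if $u$ is a $1$-sum of $\hat u$ in the direction $\theta$ and $f$ is a $1$-sum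 of $\hat f$ in the direction $\theta$, then $$u(t,z)-a(z)\int_0^t\partial_z^2u(s,z)\,ds=f(t,z)$$ for all $(t,z)$ in the intersection of the domains of $u$ and $f$, where the integral is taken along the segment from $0$ to $t$ and converges. -/

import Mathlib

open Filter Topology

noncomputable section

namespace HeatSum

/-- Extension by `0` to `ℂ` of a function given on the open disc `D_ρ` of centre `0`. -/
def extZero {ρ : ℝ} (g : Metric.ball (0 : ℂ) ρ → ℂ) : ℂ → ℂ := fun z =>
  open Classical in if h : z ∈ Metric.ball (0 : ℂ) ρ then g ⟨z, h⟩ else 0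

theorem extZero_apply {ρ : ℝ} (g : Metric.ball (0 : ℂ) ρ → ℂ) {z : ℂ}
    (h : z ∈ Metric.ball (0 : ℂ) ρ) : extZero g z = g ⟨z, h⟩ := dif_pos h

/-- The algebra `𝒪(D_ρ)` of holomorphic functions on the open disc `D_ρ`. -/
def Hol (ρ : ℝ) : Subalgebra ℂ (Metric.ball (0 : ℂ) ρ → ℂ) where
  carrier := {g | DifferentiableOn ℂ (extZero g) (Metric.ball (0 : ℂ) ρ)}
  mul_mem' := by
    intro g h hg hh
    refine (DifferentiableOn.mul hg hh).congr ?_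
    intro z hz
    simp [extZero_apply _ hz]
  add_mem' := by
    intro g h hg hh
    refine (DifferentiableOn.add hg hh).congr ?_
    intro z hz
    simp [extZero_apply _ hz]
  algebraMap_mem' := by
    intro c
    refine (differentiableOn_const c).congr ?_
    intro z hz
    simp [extZero_apply _ hz]

/-- The value `g(z)` of `g ∈ 𝒪(D_ρ)`, as a function on `ℂ` (with value `0` outside `D_ρ`). -/
def fn {ρ : ℝ} (g : Hol ρ) : ℂ → ℂ := extZero g.1

theorem differentiableOn_fn {ρ : ℝ} (g : Hol ρ) :
    DifferentiableOn ℂ (fn g) (Metric.ball (0 : ℂ) ρ) := g.2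

/-- The derivation `∂_z` of `𝒪(D_ρ)`. -/
def holDz {ρ : ℝ} (g : Hol ρ) : Hol ρ :=
  ⟨fun z => deriv (fn g) z, by
    refine (DifferentiableOn.deriv (differentiableOn_fn g) Metric.isOpen_ball).congr ?_
    intro z hz
    simp [extZero_apply _ hz]⟩

/-- The operator `∂_z` on `𝒪(D_ρ)[[t]]`, coefficient by coefficient. -/
def dz {ρ : ℝ} (u : PowerSeries (Hol ρ)) : PowerSeries (Hol ρ) :=
  PowerSeries.mk fun j => holDz (PowerSeries.coeff j u)

/-- The operator `∂_t⁻¹` on `𝒪(D_ρ)[[t]]`: the antiderivative in `t` vanishing at `t = 0`,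
which sends `c t^j` to `c t^(j+1) / (j+1)`. -/
def dtInv {ρ : ℝ} (u : PowerSeries (Hol ρ)) : PowerSeries (Hol ρ) :=
  PowerSeries.mk fun
    | 0 => 0
    | j + 1 => ((j : ℂ) + 1)⁻¹ • PowerSeries.coeff j u

/-- The heat operator `D = 1 - a(z) ∂_t⁻¹ ∂_z²` on `𝒪(D_ρ)[[t]]`. -/
def heatOp {ρ : ℝ} (a : Hol ρ) (u : PowerSeries (Hol ρ)) : PowerSeries (Hol ρ) :=
  u - PowerSeries.C a * dtInv (dz (dz u))

/-- The coefficient `u_{*,n}(t) ∈ ℂ[[t]]` of `z^n / n!` in `u(t,z) ∈ 𝒪(D_ρ)[[t]]`. -/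
def zCoeff {ρ : ℝ} (n : ℕ) (u : PowerSeries (Hol ρ)) : PowerSeries ℂ :=
  PowerSeries.mk fun j => iteratedDeriv n (fn (PowerSeries.coeff j u)) 0

/-- The open sector with vertex `0`, bisected by the direction `arg t = θ`, with opening `α` and
radius `R`. -/
def sector (θ α R : ℝ) : Set ℂ :=
  {t | ∃ s φ : ℝ, 0 < s ∧ s < R ∧ |φ - θ| < α / 2 ∧
    t = (s : ℂ) * Complex.exp ((φ : ℂ) * Complex.I)}

/-- `S` is a proper subsector of `S'`: a sector (bisected by any direction) whose closure in `ℂ`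
is contained in `S' ∪ {0}`. -/
def IsProperSubsector (S S' : Set ℂ) : Prop :=
  (∃ θ α R : ℝ, 0 < α ∧ 0 < R ∧ S = sector θ α R) ∧ closure S ⊆ S' ∪ {0}

/-- `u` is a 1-sum in the direction `θ` of the series `û ∈ 𝒪(D_ρ)[[t]]`, on the product of the
sector of opening `α > π` and radius `R` bisected by `θ` and of the disc `D_r`.
The number `û_{l,*}(z)` is `l!` times the value at `z` of the coefficient of `t^l`, and
`Γ(1 + 2 l) = (2 l)!`. Having `û` as Taylor series at `0` on the sector means that, on each proper
subsector, every derivative `∂_t^l u(t,z)` tends to `û_{l,*}(z)` as `t → 0`. -/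
structure IsOneSumOn {ρ : ℝ} (θ α R r : ℝ) (uhat : PowerSeries (Hol ρ)) (u : ℂ → ℂ → ℂ) :
    Prop where
  opening_gt : Real.pi < α
  opening_le : α ≤ 2 * Real.pi
  radius_pos : 0 < R
  disc_pos : 0 < r
  disc_le : r ≤ ρ
  holomorphic : DifferentiableOn ℂ (fun p : ℂ × ℂ => u p.1 p.2)
    (sector θ α R ×ˢ Metric.ball (0 : ℂ) r)
  taylor : ∀ S : Set ℂ, IsProperSubsector S (sector θ α R) →
    ∀ z ∈ Metric.ball (0 : ℂ) r, ∀ l : ℕ,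
      Tendsto (iteratedDeriv l fun t => u t z) (𝓝[S] 0)
        (𝓝 ((Nat.factorial l : ℂ) * fn (PowerSeries.coeff l uhat) z))
  gevrey : ∀ S : Set ℂ, IsProperSubsector S (sector θ α R) →
    ∃ C K : ℝ, 0 < C ∧ 0 < K ∧ ∀ l : ℕ, ∀ t ∈ S, ∀ z ∈ Metric.ball (0 : ℂ) r,
      ‖iteratedDeriv l (fun s => u s z) t‖ ≤ C * K ^ l * (Nat.factorial (2 * l) : ℝ)

/-- The series `û ∈ 𝒪(D_ρ)[[t]]` is 1-summable in the direction `θ`, uniformly in `z` near `0`. -/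
def IsOneSummable {ρ : ℝ} (θ : ℝ) (uhat : PowerSeries (Hol ρ)) : Prop :=
  ∃ (α R r : ℝ) (u : ℂ → ℂ → ℂ), IsOneSumOn θ α R r uhat u

/-- `u` is a 1-sum in the direction `θ` of the series `û ∈ ℂ[[t]]` (no parameter), on the sector
of opening `α > π` and radius `R` bisected by `θ`. -/
structure IsScalarOneSumOn (θ α R : ℝ) (uhat : PowerSeries ℂ) (u : ℂ → ℂ) : Prop where
  opening_gt : Real.pi < α
  opening_le : α ≤ 2 * Real.pi
  radius_pos : 0 < R
  holomorphic : DifferentiableOn ℂ u (sector θ α R)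
  taylor : ∀ S : Set ℂ, IsProperSubsector S (sector θ α R) → ∀ l : ℕ,
    Tendsto (iteratedDeriv l u) (𝓝[S] 0)
      (𝓝 ((Nat.factorial l : ℂ) * PowerSeries.coeff l uhat))
  gevrey : ∀ S : Set ℂ, IsProperSubsector S (sector θ α R) →
    ∃ C K : ℝ, 0 < C ∧ 0 < K ∧ ∀ l : ℕ, ∀ t ∈ S,
      ‖iteratedDeriv l u t‖ ≤ C * K ^ l * (Nat.factorial (2 * l) : ℝ)

/-- The series `û ∈ ℂ[[t]]` is 1-summable in the direction `θ`. -/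
def IsScalarOneSummable (θ : ℝ) (uhat : PowerSeries ℂ) : Prop :=
  ∃ (α R : ℝ) (u : ℂ → ℂ), IsScalarOneSumOn θ α R uhat u

/-- The functions `u`, `f` satisfy `(1 - a(z) ∂_t⁻¹ ∂_z²) u = f` at the point `(t,z)`, where
`∂_t⁻¹ g (t) = ∫_0^t g(s) ds` is the integral along the segment from `0` to `t`
(parametrized by `s = x t`, `0 ≤ x ≤ 1`), which is required to converge. -/
def SatisfiesHeatAt {ρ : ℝ} (a : Hol ρ) (u f : ℂ → ℂ → ℂ) (t z : ℂ) : Prop :=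
  IntervalIntegrable (fun x : ℝ => iteratedDeriv 2 (u ((x : ℂ) * t)) z)
      MeasureTheory.volume 0 1 ∧
    u t z - fn a z * (t * ∫ x in (0 : ℝ)..1, iteratedDeriv 2 (u ((x : ℂ) * t)) z) = f t z

end HeatSum

end

/-!
The argument is carried out on the expansions in powers of `z`. On a slightly smaller sector `S`,
still of opening larger than `π`, a `1`-sum `u` of `û` is the same thing as a sequence of functions
`v n` of `t` alone, `u = ∑ v n (t) z ^ n`, such that `v n` has the coefficient of `z ^ n` in `û` as
Taylor series at `0` and satisfies `|∂_t^l (v n)| ≤ C M ^ n K ^ l (2l)!` on `S` (`IsCoeffSum`): in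
one direction by Cauchy's integrals in `z` (`IsOneSumOn.isCoeffSum`), in the other by summation
(`IsCoeffSum.isOneSumOn`). No theory of functions of two variables is needed beyond this.

With `a = ∑ a_k z ^ k`, the equation differentiated in `t` becomes
`∂_t f_n = ∂_t u_n - ∑_{k ≤ n} a_{n-k} (k+2) (k+1) u_{k+2}`.

* If `û` is summable, this relation, after an integration in `t` from the vertex
  (`exists_primitive`), defines the coefficients of a `1`-sum of `f̂` (`IsCoeffSum.heatOp`).
* Conversely, let `q` be the order of vanishing of `a` at `0`, so that `q ≤ 1`. The relation of
  index `n + q` gives `u_{n+2}` in terms of `∂_t u_{n+q}`, `∂_t f_{n+q}` and `u_2, …, u_{n+1}`.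
  Hence the functions `u_0` and `u_1` and the right-hand side determine all the `u_n`
  (`solveCoeff`). Each step loses one derivative in `t` but gains a division by `(n+2)(n+1)`, and
  the two balance in the Gevrey order `1`: the weights `(2l + 2n)! / (2n)!` majorize the recursion
  (`le_of_recursion`), and exceed `(2l)!` by a geometric factor only. This is where the order of
  vanishing has to be at most `1`: the relation of index `n + q` involves `∂_t u_{n+q}`, which is
  known before `u_{n+2}` only if `q < 2`.

The equation for the `1`-sums holds, after differentiation in `t`, by Watson's lemma
(`eqOn_zero_of_flat`): the difference of the two sides has a zero Taylor series at the vertex and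
Gevrey estimates of order `1`, hence vanishes as the opening of the sector is larger than `π`. It
is then integrated along the segment from `0` to `t`.
-/

noncomputable section

namespace HeatSum

/-! ### Sectors -/

/-- A sector is the image of a half-strip by the exponential, hence open and connected. -/
theorem sector_eq_image_exp (θ α R : ℝ) (hR : 0 < R) :
    sector θ α R = Complex.exp '' {w : ℂ | w.re < Real.log R ∧ |w.im - θ| < α / 2} := by
  ext t
  constructor
  · rintro ⟨s, φ, hs, hsR, hφ, rfl⟩
    refine ⟨(Real.log s : ℂ) + φ * Complex.I, ?_, ?_⟩
    · simpa using ⟨Real.log_lt_log hs hsR, hφ⟩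
    · rw [Complex.exp_add, ← Complex.ofReal_exp, Real.exp_log hs]
  · rintro ⟨w, ⟨h1, h2⟩, rfl⟩
    refine ⟨Real.exp w.re, w.im, Real.exp_pos _, ?_, h2, ?_⟩
    · rwa [← Real.lt_log_iff_exp_lt hR]
    · rw [Complex.ofReal_exp, ← Complex.exp_add, Complex.re_add_im]

theorem isOpen_sector (θ α R : ℝ) (hR : 0 < R) : IsOpen (sector θ α R) := by
  rw [sector_eq_image_exp _ _ _ hR]
  have h1 : IsOpen {w : ℂ | w.re < Real.log R} :=
    isOpen_lt Complex.continuous_re continuous_const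
  have h2 : IsOpen {w : ℂ | |w.im - θ| < α / 2} :=
    isOpen_lt (Complex.continuous_im.sub continuous_const).abs continuous_const
  exact Complex.isOpenMap_exp _ (h1.inter h2)

theorem isPreconnected_sector (θ α R : ℝ) (hR : 0 < R) : IsPreconnected (sector θ α R) := by
  rw [sector_eq_image_exp _ _ _ hR]
  refine IsPreconnected.image (Convex.isPreconnected ?_) _ Complex.continuous_exp.continuousOn
  have : {w : ℂ | |w.im - θ| < α / 2} =
      {w : ℂ | w.im < α / 2 + θ} ∩ {w : ℂ | θ - α / 2 < w.im} := by
    ext w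
    simp only [Set.mem_ofPred_eq, Set.mem_inter_iff, abs_lt]
    constructor
    · rintro ⟨h1, h2⟩; constructor <;> linarith
    · rintro ⟨h1, h2⟩; constructor <;> linarith
  have h2 : Convex ℝ {w : ℂ | |w.im - θ| < α / 2} :=
    this ▸ (convex_halfSpace_im_lt _).inter (convex_halfSpace_im_gt _)
  exact (convex_halfSpace_re_lt _).inter h2

theorem norm_of_polar {s φ : ℝ} (hs : 0 ≤ s) :
    ‖(s : ℂ) * Complex.exp ((φ : ℂ) * Complex.I)‖ = s := by
  rw [norm_mul, Complex.norm_exp_ofReal_mul_I, mul_one, Complex.norm_real, Real.norm_of_nonneg hs]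

theorem norm_pos_of_mem_sector {θ α R : ℝ} {t : ℂ} (ht : t ∈ sector θ α R) : 0 < ‖t‖ := by
  obtain ⟨s, φ, hs, -, -, rfl⟩ := ht
  rwa [norm_of_polar hs.le]

theorem norm_lt_of_mem_sector {θ α R : ℝ} {t : ℂ} (ht : t ∈ sector θ α R) : ‖t‖ < R := by
  obtain ⟨s, φ, hs, h, -, rfl⟩ := ht
  rwa [norm_of_polar hs.le]

theorem zero_notMem_sector (θ α R : ℝ) : (0 : ℂ) ∉ sector θ α R := fun h => by
  simpa using norm_pos_of_mem_sector h

theorem smul_mem_sector {θ α R : ℝ} {t : ℂ} (ht : t ∈ sector θ α R) {x : ℝ} (h0 : 0 < x)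
    (h1 : x ≤ 1) : (x : ℂ) * t ∈ sector θ α R := by
  obtain ⟨s, φ, hs, h, h', rfl⟩ := ht
  refine ⟨x * s, φ, by positivity, ?_, h', by push_cast; ring⟩
  exact (mul_le_of_le_one_left hs.le h1).trans_lt h

theorem isProperSubsector_sector {θ α R α' R' : ℝ} (h0 : 0 < α) (hα : α < α') (hR0 : 0 < R)
    (hR : R < R') : IsProperSubsector (sector θ α R) (sector θ α' R') := by
  refine ⟨⟨θ, α, R, h0, hR0, rfl⟩, ?_⟩
  -- the closed polar rectangle is compact, and so is its image
  set Q : Set ℂ := (fun p : ℝ × ℝ => (p.1 : ℂ) * Complex.exp ((p.2 : ℂ) * Complex.I)) ''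
    (Set.Icc 0 R ×ˢ Set.Icc (θ - α / 2) (θ + α / 2)) with hQ
  have hc : IsCompact Q := (isCompact_Icc.prod isCompact_Icc).image (by fun_prop)
  have hsub : sector θ α R ⊆ Q := by
    rintro t ⟨s, φ, hs, h, h', rfl⟩
    rw [abs_lt] at h'
    exact ⟨(s, φ), ⟨⟨hs.le, h.le⟩, by constructor <;> linarith⟩, rfl⟩
  refine (closure_minimal hsub hc.isClosed).trans ?_
  rintro _ ⟨⟨s, φ⟩, ⟨⟨h1, h2⟩, h3, h4⟩, rfl⟩
  simp only at h1 h2 h3 h4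
  rcases h1.eq_or_lt with rfl | h1
  · right; simp
  · left
    refine ⟨s, φ, h1, by linarith, ?_, rfl⟩
    rw [abs_lt]
    constructor <;> linarith

theorem IsProperSubsector.subset {S S' : Set ℂ} (h : IsProperSubsector S S') : S ⊆ S' := by
  obtain ⟨⟨θ, α, R, -, -, rfl⟩, h⟩ := h
  intro t ht
  rcases h (subset_closure ht) with h | h
  · exact h
  · rw [Set.mem_singleton_iff] at h
    exact absurd (h ▸ ht) (zero_notMem_sector _ _ _)

/-- A common point of two sectors with the same bisecting direction lies in a smaller such sector,
properly contained in both. The openings must be at most `2 π` for the polar angle, measured from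
the bisecting direction, to be unique. -/
theorem exists_common_subsector {θ α R α' R' : ℝ} {t : ℂ} (hα : Real.pi < α)
    (hα2 : α ≤ 2 * Real.pi) (hα' : Real.pi < α') (hα2' : α' ≤ 2 * Real.pi)
    (ht : t ∈ sector θ α R) (ht' : t ∈ sector θ α' R') :
    ∃ α₁ R₁, Real.pi < α₁ ∧ α₁ < α ∧ α₁ < α' ∧ 0 < R₁ ∧ R₁ < R ∧ R₁ < R' ∧
      t ∈ sector θ α₁ R₁ := by
  obtain ⟨s, φ, hs, h, h', rfl⟩ := ht
  obtain ⟨s', φ', hs', h1, h1', he⟩ := ht'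
  have hss : s = s' := by
    have := congrArg norm he
    rwa [norm_of_polar hs.le, norm_of_polar hs'.le] at this
  subst hss
  have hsne : (s : ℂ) ≠ 0 := by exact_mod_cast hs.ne'
  obtain ⟨n, hn⟩ := Complex.exp_eq_exp_iff_exists_int.1 (mul_left_cancel₀ hsne he)
  have hφ : φ = φ' + n * (2 * Real.pi) := by
    have := congrArg Complex.im hn
    simpa using this
  have hn0 : n = 0 := by
    rw [abs_lt] at h' h1'
    have hpi := Real.pi_pos
    have h3 : (n : ℝ) * (2 * Real.pi) < 1 * (2 * Real.pi) := by nlinarith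
    have h4 : (-1 : ℝ) * (2 * Real.pi) < n * (2 * Real.pi) := by nlinarith
    have h5 : (n : ℝ) < 1 := lt_of_mul_lt_mul_right h3 (by positivity)
    have h6 : (-1 : ℝ) < n := lt_of_mul_lt_mul_right h4 (by positivity)
    have h7 : n < 1 := by exact_mod_cast h5
    have h8 : -1 < n := by exact_mod_cast h6
    omega
  have hφ : φ = φ' := by simpa [hn0] using hφ
  subst hφ
  obtain ⟨α₁, h2, h3⟩ := exists_between (show max Real.pi (2 * |φ - θ|) < min α α' by
    simp only [max_lt_iff, lt_min_iff]; refine ⟨⟨hα, ?_⟩, hα', ?_⟩ <;> linarith)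
  obtain ⟨R₁, h4, h5⟩ := exists_between (show s < min R R' from lt_min h h1)
  simp only [max_lt_iff, lt_min_iff] at h2 h3 h5
  exact ⟨α₁, R₁, h2.1, h3.1, h3.2, by linarith, h5.1, h5.2, s, φ, hs, h4, by linarith, rfl⟩

/-- Along the segment from `0` to a point of the sector, the vertex is approached inside the
sector. -/
theorem tendsto_segment_nhdsWithin_sector {θ α R : ℝ} {t : ℂ} (ht : t ∈ sector θ α R) :
    Tendsto (fun x : ℝ => (x : ℂ) * t) (𝓝[>] 0) (𝓝[sector θ α R] 0) := by
  refine tendsto_nhdsWithin_iff.2 ⟨?_, ?_⟩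
  · have : Tendsto (fun x : ℝ => (x : ℂ) * t) (𝓝 0) (𝓝 (((0 : ℝ) : ℂ) * t)) :=
      Continuous.tendsto (by fun_prop) 0
    simpa using this.mono_left nhdsWithin_le_nhds
  · filter_upwards [Ioo_mem_nhdsGT (zero_lt_one (α := ℝ))] with x hx
    exact smul_mem_sector ht hx.1 hx.2.le

/-! ### Taylor series at the vertex, Gevrey estimates and primitives -/

/-- The function `v` is holomorphic on `S`, and its `l`-th derivative tends to `d l` at the
boundary point `0` of `S`: it has `∑ d l t^l / l!` as Taylor series at `0` on `S`. -/
structure HasExpansion (S : Set ℂ) (d : ℕ → ℂ) (v : ℂ → ℂ) : Prop where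
  diff : DifferentiableOn ℂ v S
  lim : ∀ l, Tendsto (iteratedDeriv l v) (𝓝[S] 0) (𝓝 (d l))

/-- The Gevrey estimates of order `1` for the derivatives of `v` on `S`. -/
def GevreyOn (S : Set ℂ) (C K : ℝ) (v : ℂ → ℂ) : Prop :=
  ∀ l : ℕ, ∀ t ∈ S, ‖iteratedDeriv l v t‖ ≤ C * K ^ l * (Nat.factorial (2 * l) : ℝ)

section

variable {S : Set ℂ} {d e : ℕ → ℂ} {v w : ℂ → ℂ}

theorem contDiffAt_of_differentiableOn (hS : IsOpen S) (h : DifferentiableOn ℂ v S) {t : ℂ}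
    (ht : t ∈ S) (n : ℕ) : ContDiffAt ℂ n v t :=
  (h.analyticAt (hS.mem_nhds ht)).contDiffAt

theorem differentiableOn_iteratedDeriv (hS : IsOpen S) (h : DifferentiableOn ℂ v S) (l : ℕ) :
    DifferentiableOn ℂ (iteratedDeriv l v) S := by
  induction l with
  | zero => simpa using h
  | succ l ih => rw [iteratedDeriv_succ]; exact ih.deriv hS

theorem iteratedDeriv_congr_of_isOpen (hS : IsOpen S) (h : Set.EqOn v w S) (l : ℕ) :
    Set.EqOn (iteratedDeriv l v) (iteratedDeriv l w) S := fun _ ht =>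
  (h.eventuallyEq_of_mem (hS.mem_nhds ht)).iteratedDeriv_eq l

theorem HasExpansion.mono (h : HasExpansion S d v) {S' : Set ℂ} (hS : S' ⊆ S) :
    HasExpansion S' d v :=
  ⟨h.diff.mono hS, fun l => (h.lim l).mono_left (nhdsWithin_mono _ hS)⟩

theorem HasExpansion.congr (hS : IsOpen S) (h : HasExpansion S d v) (hvw : Set.EqOn w v S) :
    HasExpansion S d w :=
  ⟨h.diff.congr hvw, fun l => (h.lim l).congr' (by
    filter_upwards [self_mem_nhdsWithin] with t ht
    exact (iteratedDeriv_congr_of_isOpen hS hvw l ht).symm)⟩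

theorem HasExpansion.congr_coeff (h : HasExpansion S d v) (hde : ∀ l, d l = e l) :
    HasExpansion S e v :=
  (funext hde : d = e) ▸ h

theorem HasExpansion.sub (hS : IsOpen S) (hv : HasExpansion S d v) (hw : HasExpansion S e w) :
    HasExpansion S (fun l => d l - e l) (fun t => v t - w t) := by
  refine ⟨hv.diff.sub hw.diff, fun l => ((hv.lim l).sub (hw.lim l)).congr' ?_⟩
  filter_upwards [self_mem_nhdsWithin] with t ht
  exact (iteratedDeriv_fun_sub (contDiffAt_of_differentiableOn hS hv.diff ht l)
    (contDiffAt_of_differentiableOn hS hw.diff ht l)).symm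

theorem HasExpansion.const_mul (hv : HasExpansion S d v) (c : ℂ) :
    HasExpansion S (fun l => c * d l) (fun t => c * v t) := by
  refine ⟨hv.diff.const_mul c, fun l => ?_⟩
  have : iteratedDeriv l (fun t => c * v t) = fun t => c * iteratedDeriv l v t :=
    funext fun t => iteratedDeriv_const_mul_field c v
  rw [this]
  exact (hv.lim l).const_mul c

theorem HasExpansion.sum (hS : IsOpen S) {ι : Type*} (s : Finset ι) {d : ι → ℕ → ℂ}
    {v : ι → ℂ → ℂ} (h : ∀ i ∈ s, HasExpansion S (d i) (v i)) :
    HasExpansion S (fun l => ∑ i ∈ s, d i l) (fun t => ∑ i ∈ s, v i t) := by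
  refine ⟨DifferentiableOn.fun_sum fun i hi => (h i hi).diff, fun l =>
    (tendsto_finsetSum s fun i hi => (h i hi).lim l).congr' ?_⟩
  filter_upwards [self_mem_nhdsWithin] with t ht
  exact (iteratedDeriv_fun_sum fun i hi =>
    contDiffAt_of_differentiableOn hS (h i hi).diff ht l).symm

theorem HasExpansion.deriv (hS : IsOpen S) (hv : HasExpansion S d v) :
    HasExpansion S (fun l => d (l + 1)) (deriv v) := by
  refine ⟨hv.diff.deriv hS, fun l => ?_⟩
  rw [← iteratedDeriv_succ']
  exact hv.lim (l + 1)

end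

section

variable {θ α R : ℝ}

theorem hasDerivAt_comp_segment {V : ℂ → ℂ} {V' t : ℂ} {x : ℝ}
    (h : HasDerivAt V V' ((x : ℂ) * t)) : HasDerivAt (fun y : ℝ => V ((y : ℂ) * t)) (t * V') x := by
  have h1 : HasDerivAt (fun y : ℝ => (y : ℂ) * t) (1 * t) x :=
    (Complex.ofRealCLM.hasDerivAt (x := x)).mul_const t
  have := HasDerivAt.scomp x h h1
  simpa [Function.comp_def] using this

theorem continuousOn_segment {v : ℂ → ℂ} (hv : ContinuousOn v (sector θ α R)) {t : ℂ}
    (ht : t ∈ sector θ α R) : ContinuousOn (fun x : ℝ => v ((x : ℂ) * t)) (Set.Ioc 0 1) :=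
  hv.comp (by fun_prop) fun _ hx => smul_mem_sector ht hx.1 hx.2

theorem intervalIntegrable_segment {g : ℝ → ℂ} {B : ℝ} (hg : ContinuousOn g (Set.Ioc 0 1))
    (hB : ∀ x ∈ Set.Ioc (0 : ℝ) 1, ‖g x‖ ≤ B) :
    IntervalIntegrable g MeasureTheory.volume 0 1 := by
  rw [intervalIntegrable_iff_integrableOn_Ioc_of_le zero_le_one]
  exact MeasureTheory.IntegrableOn.of_bound measure_Ioc_lt_top
    (hg.aestronglyMeasurable measurableSet_Ioc) B
    ((MeasureTheory.ae_restrict_iff' measurableSet_Ioc).2 (Eventually.of_forall hB))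

/-- The fundamental theorem of calculus on the segment from the vertex of a sector to one of its
points, for a function with a limit at the vertex and a bounded derivative. -/
theorem integral_segment {V v : ℂ → ℂ} {V₀ : ℂ} {B : ℝ}
    (hV : ∀ t ∈ sector θ α R, HasDerivAt V (v t) t) (hv : ContinuousOn v (sector θ α R))
    (hB : ∀ t ∈ sector θ α R, ‖v t‖ ≤ B) (h0 : Tendsto V (𝓝[sector θ α R] 0) (𝓝 V₀)) {t : ℂ}
    (ht : t ∈ sector θ α R) :
    IntervalIntegrable (fun x : ℝ => v ((x : ℂ) * t)) MeasureTheory.volume 0 1 ∧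
      t * ∫ x in (0 : ℝ)..1, v ((x : ℂ) * t) = V t - V₀ := by
  have hi : IntervalIntegrable (fun x : ℝ => v ((x : ℂ) * t)) MeasureTheory.volume 0 1 :=
    intervalIntegrable_segment (continuousOn_segment hv ht)
      fun x hx => hB _ (smul_mem_sector ht hx.1 hx.2)
  refine ⟨hi, ?_⟩
  rw [← intervalIntegral.integral_const_mul]
  refine intervalIntegral.integral_eq_sub_of_hasDerivAt_of_tendsto (f := fun x : ℝ => V (x * t))
    zero_lt_one (fun x hx => hasDerivAt_comp_segment (hV _ (smul_mem_sector ht hx.1 hx.2.le)))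
    (hi.const_mul t) (h0.comp (tendsto_segment_nhdsWithin_sector ht)) ?_
  have h1 := (hasDerivAt_comp_segment (x := 1) (by simpa using hV t ht)).continuousAt.tendsto
  simpa using h1.mono_left (nhdsWithin_le_nhds (s := Set.Iio 1))

/-- The primitive `t ↦ ∫_0^t v` of a function on a sector that is bounded with its derivative.
It is written as `∫_0^1 t v(xt) dx` and differentiated under the integral sign: the integrand of the
derivative is `d/dx (x v(xt))`. -/
theorem exists_primitive (hR : 0 < R) {d : ℕ → ℂ} {v : ℂ → ℂ}
    (hv : HasExpansion (sector θ α R) d v) {B₀ B₁ : ℝ}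
    (hB₀ : ∀ t ∈ sector θ α R, ‖v t‖ ≤ B₀) (hB₁ : ∀ t ∈ sector θ α R, ‖deriv v t‖ ≤ B₁) :
    ∃ V : ℂ → ℂ, HasExpansion (sector θ α R) (fun | 0 => 0 | l + 1 => d l) V ∧
      (∀ l, Set.EqOn (iteratedDeriv (l + 1) V) (iteratedDeriv l v) (sector θ α R)) ∧
      ∀ t ∈ sector θ α R, ‖V t‖ ≤ R * B₀ := by
  set S := sector θ α R with hSdef
  have hS : IsOpen S := isOpen_sector θ α R hR
  have hderiv : ∀ t ∈ S, HasDerivAt v (deriv v t) t := fun t ht =>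
    (hv.diff.differentiableAt (hS.mem_nhds ht)).hasDerivAt
  have hc' : ContinuousOn (deriv v) S := (hv.diff.deriv hS).continuousOn
  set V : ℂ → ℂ := fun t => ∫ x in (0 : ℝ)..1, t * v ((x : ℂ) * t) with hVdef
  have hbd : ∀ t ∈ S, ‖V t‖ ≤ ‖t‖ * B₀ := by
    intro t ht
    have := intervalIntegral.norm_integral_le_of_norm_le_const (a := (0 : ℝ)) (b := 1)
      (f := fun x : ℝ => t * v ((x : ℂ) * t)) (C := ‖t‖ * B₀) (fun x hx => by
        rw [Set.uIoc_of_le zero_le_one] at hx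
        rw [norm_mul]
        exact mul_le_mul_of_nonneg_left (hB₀ _ (smul_mem_sector ht hx.1 hx.2)) (norm_nonneg _))
    rw [sub_zero, abs_one, mul_one] at this
    exact this
  have hV : ∀ t ∈ S, HasDerivAt V (v t) t := by
    intro t ht
    have hmeas : ∀ g : ℂ → ℂ, ContinuousOn g S → ∀ t ∈ S,
        ContinuousOn (fun x : ℝ => g ((x : ℂ) * t)) (Set.Ioc 0 1) := fun g hg t ht =>
      continuousOn_segment hg ht
    have key := intervalIntegral.hasDerivAt_integral_of_dominated_loc_of_deriv_le
      (μ := MeasureTheory.volume) (a := (0 : ℝ)) (b := 1) (𝕜 := ℂ) (s := S) (x₀ := t)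
      (F := fun t x => t * v ((x : ℂ) * t))
      (F' := fun t x => v ((x : ℂ) * t) + t * (x * deriv v ((x : ℂ) * t)))
      (bound := fun _ => B₀ + R * B₁) (hS.mem_nhds ht) ?_ ?_ ?_ ?_ ?_ ?_
    · have h2 : ∫ x in (0 : ℝ)..1, (v ((x : ℂ) * t) + t * (x * deriv v ((x : ℂ) * t))) = v t := by
        have hd : ∀ x ∈ Set.Ioc (0 : ℝ) 1, HasDerivAt (fun x : ℝ => (x : ℂ) * v ((x : ℂ) * t))
            (v ((x : ℂ) * t) + t * (x * deriv v ((x : ℂ) * t))) x := by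
          intro x hx
          have h3 := (Complex.ofRealCLM.hasDerivAt (x := x)).mul
            (hasDerivAt_comp_segment (hderiv _ (smul_mem_sector ht hx.1 hx.2)))
          refine HasDerivAt.congr_deriv h3 ?_
          simp only [Complex.ofRealCLM_apply, Complex.ofReal_one]
          ring
        have h0 : Tendsto (fun x : ℝ => (x : ℂ) * v ((x : ℂ) * t)) (𝓝[>] 0) (𝓝 0) := by
          have h4 : Tendsto (fun x : ℝ => (x : ℂ)) (𝓝[>] 0) (𝓝 0) := by
            have := (Complex.continuous_ofReal.tendsto 0).mono_left
              (nhdsWithin_le_nhds (s := Set.Ioi 0))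
            simpa using this
          have h5 := (hv.lim 0).comp (tendsto_segment_nhdsWithin_sector ht)
          simpa using h4.mul h5
        have h1 : Tendsto (fun x : ℝ => (x : ℂ) * v ((x : ℂ) * t)) (𝓝[<] 1) (𝓝 (v t)) := by
          have := (hd 1 (by simp)).continuousAt.tendsto.mono_left
            (nhdsWithin_le_nhds (s := Set.Iio 1))
          simpa using this
        have := intervalIntegral.integral_eq_sub_of_hasDerivAt_of_tendsto zero_lt_one
          (fun x hx => hd x ⟨hx.1, hx.2.le⟩) key.1 h0 h1
        simpa using this
      rw [← h2]
      exact key.2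
    · filter_upwards [hS.mem_nhds ht] with y hy
      rw [Set.uIoc_of_le zero_le_one]
      exact (continuousOn_const.mul (hmeas v hv.diff.continuousOn y hy)).aestronglyMeasurable
        measurableSet_Ioc
    · exact (intervalIntegrable_segment (hmeas v hv.diff.continuousOn t ht)
        fun x hx => hB₀ _ (smul_mem_sector ht hx.1 hx.2)).const_mul t
    · rw [Set.uIoc_of_le zero_le_one]
      exact ((hmeas v hv.diff.continuousOn t ht).add (continuousOn_const.mul
        ((by fun_prop : Continuous fun x : ℝ => (x : ℂ)).continuousOn.mul
          (hmeas _ hc' t ht)))).aestronglyMeasurable measurableSet_Ioc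
    · refine Eventually.of_forall fun x hx y hy => ?_
      rw [Set.uIoc_of_le zero_le_one] at hx
      refine (norm_add_le _ _).trans (add_le_add (hB₀ _ (smul_mem_sector hy hx.1 hx.2)) ?_)
      rw [norm_mul, norm_mul, Complex.norm_real, Real.norm_of_nonneg hx.1.le]
      have h6 := hB₁ _ (smul_mem_sector hy hx.1 hx.2)
      refine mul_le_mul (norm_lt_of_mem_sector hy).le ?_
        (mul_nonneg hx.1.le (norm_nonneg _)) hR.le
      exact (mul_le_of_le_one_left (norm_nonneg _) hx.2).trans h6
    · simp
    · refine Eventually.of_forall fun x hx y hy => ?_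
      rw [Set.uIoc_of_le zero_le_one] at hx
      have h7 : HasDerivAt (fun y : ℂ => v ((x : ℂ) * y)) (deriv v ((x : ℂ) * y) * x) y := by
        have := (hderiv _ (smul_mem_sector hy hx.1 hx.2)).comp y
          ((hasDerivAt_id y).const_mul (x : ℂ))
        simpa [Function.comp_def] using this
      refine HasDerivAt.congr_deriv ((hasDerivAt_id y).mul h7) ?_
      simp only [id]
      ring
  have hit : ∀ l, Set.EqOn (iteratedDeriv (l + 1) V) (iteratedDeriv l v) S := fun l => by
    rw [iteratedDeriv_succ']
    exact iteratedDeriv_congr_of_isOpen hS (fun t ht => (hV t ht).deriv) l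
  refine ⟨V, ⟨fun t ht => (hV t ht).differentiableAt.differentiableWithinAt, ?_⟩, hit, ?_⟩
  · rintro (_ | l)
    · rw [iteratedDeriv_zero]
      refine squeeze_zero_norm' (a := fun t => ‖t‖ * B₀) ?_ ?_
      · filter_upwards [self_mem_nhdsWithin] with t ht using hbd t ht
      · have : Tendsto (fun t : ℂ => ‖t‖ * B₀) (𝓝 0) (𝓝 (‖(0 : ℂ)‖ * B₀)) :=
          Continuous.tendsto (by fun_prop) 0
        simpa using this.mono_left nhdsWithin_le_nhds
    · refine (hv.lim l).congr' ?_
      filter_upwards [self_mem_nhdsWithin] with t ht using (hit l ht).symm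
  · intro t ht
    have hB : 0 ≤ B₀ := (norm_nonneg _).trans (hB₀ t ht)
    exact (hbd t ht).trans (mul_le_mul_of_nonneg_right (norm_lt_of_mem_sector ht).le hB)

end

/-! ### Watson's lemma -/

theorem factorial_add_le (m n : ℕ) :
    ((m + n).factorial : ℝ) ≤ 2 ^ (m + n) * (m.factorial * n.factorial) := by
  have h := Nat.add_choose_mul_factorial_mul_factorial m n
  have h2 := Nat.choose_le_two_pow (m + n) n
  have : (m + n).factorial ≤ 2 ^ (m + n) * (m.factorial * n.factorial) := by
    rw [← h, mul_assoc]
    exact Nat.mul_le_mul_right _ h2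
  exact_mod_cast this

section

variable {θ α R : ℝ}

/-- Taylor's estimate at the vertex of a sector for a function whose derivatives all tend to `0`
there. -/
theorem norm_le_of_flat (hR : 0 < R) (l : ℕ) {h : ℂ → ℂ} {B : ℝ}
    (hh : HasExpansion (sector θ α R) (fun _ => 0) h)
    (hB : ∀ t ∈ sector θ α R, ‖iteratedDeriv l h t‖ ≤ B) :
    ∀ t ∈ sector θ α R, ‖h t‖ ≤ B * ‖t‖ ^ l / l.factorial := by
  induction l generalizing h with
  | zero => simpa using hB
  | succ l ih =>
    intro t ht
    have hB0 : 0 ≤ B := (norm_nonneg _).trans (hB t ht)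
    have hS : IsOpen (sector θ α R) := isOpen_sector θ α R hR
    have h1 := ih (hh.deriv hS) (by simpa only [iteratedDeriv_succ'] using hB)
    have hbd : ∀ t ∈ sector θ α R, ‖deriv h t‖ ≤ B * R ^ l / l.factorial := fun t ht =>
      (h1 t ht).trans (by gcongr; exact (norm_lt_of_mem_sector ht).le)
    have h2 := (integral_segment
      (fun t ht => (hh.diff.differentiableAt (hS.mem_nhds ht)).hasDerivAt)
      (hh.diff.deriv hS).continuousOn hbd (by simpa using hh.lim 0) ht).2
    rw [sub_zero] at h2
    rw [← h2, norm_mul]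
    have h3 : ‖∫ x in (0 : ℝ)..1, deriv h ((x : ℂ) * t)‖ ≤
        ∫ x in (0 : ℝ)..1, B * ‖t‖ ^ l / l.factorial * x ^ l := by
      refine intervalIntegral.norm_integral_le_of_norm_le zero_le_one ?_
        (Continuous.intervalIntegrable (by fun_prop) _ _)
      refine Eventually.of_forall fun x hx => ?_
      refine (h1 _ (smul_mem_sector ht hx.1 hx.2)).trans (le_of_eq ?_)
      rw [norm_mul, Complex.norm_real, Real.norm_of_nonneg hx.1.le]
      ring
    have h4 : ∫ x in (0 : ℝ)..1, B * ‖t‖ ^ l / l.factorial * x ^ l =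
        B * ‖t‖ ^ l / l.factorial * (1 / (l + 1)) := by
      rw [intervalIntegral.integral_const_mul, integral_pow]
      simp
    calc ‖t‖ * ‖∫ x in (0 : ℝ)..1, deriv h ((x : ℂ) * t)‖
        ≤ ‖t‖ * (B * ‖t‖ ^ l / l.factorial * (1 / (l + 1))) :=
          mul_le_mul_of_nonneg_left (h3.trans h4.le) (norm_nonneg _)
      _ = B * ‖t‖ ^ (l + 1) / (l + 1).factorial := by
          rw [Nat.factorial_succ]
          push_cast
          field_simp
          ring

/-- A function that is flat of Gevrey order `1` decays exponentially in `1 / ‖t‖`. -/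
theorem norm_le_exp_of_flat (hR : 0 < R) {h : ℂ → ℂ} {C K : ℝ} (hC : 0 < C) (hK : 0 < K)
    (hh : HasExpansion (sector θ α R) (fun _ => 0) h) (hG : GevreyOn (sector θ α R) C K h) :
    ∀ t ∈ sector θ α R,
      ‖h t‖ ≤ C * Real.exp 1 * Real.exp (-((Real.exp 1 * (4 * K))⁻¹ / ‖t‖)) := by
  intro t ht
  have htp := norm_pos_of_mem_sector ht
  set y : ℝ := (Real.exp 1 * (4 * K))⁻¹ / ‖t‖ with hy
  have hy0 : 0 ≤ y := by positivity
  -- the best estimate is the one of order `l ≈ y`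
  set l : ℕ := ⌊y⌋₊ with hl
  have hly : (l : ℝ) ≤ y := Nat.floor_le hy0
  have hyl : y < l + 1 := Nat.lt_floor_add_one y
  have h1 := norm_le_of_flat hR l hh (hG l) t ht
  have h2 : ((2 * l).factorial : ℝ) ≤ 4 ^ l * (l.factorial * l.factorial) := by
    have := factorial_add_le l l
    rw [← two_mul, pow_mul] at this
    norm_num at this ⊢
    exact this
  have h3 : (l.factorial : ℝ) ≤ (l : ℝ) ^ l := by exact_mod_cast Nat.factorial_le_pow l
  have h4 : 4 * K * ‖t‖ * l ≤ Real.exp (-1) := by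
    have : 4 * K * ‖t‖ * l ≤ 4 * K * ‖t‖ * y := by gcongr
    refine this.trans (le_of_eq ?_)
    rw [hy, Real.exp_neg]
    field_simp
  calc ‖h t‖ ≤ C * K ^ l * ((2 * l).factorial : ℝ) * ‖t‖ ^ l / l.factorial := h1
    _ ≤ C * K ^ l * (4 ^ l * (l.factorial * l.factorial)) * ‖t‖ ^ l / l.factorial := by gcongr
    _ = C * (4 * K * ‖t‖) ^ l * l.factorial := by
        rw [mul_pow, mul_pow]
        field_simp
    _ ≤ C * (4 * K * ‖t‖) ^ l * (l : ℝ) ^ l := by gcongr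
    _ = C * (4 * K * ‖t‖ * l) ^ l := by rw [mul_pow (4 * K * ‖t‖)]; ring
    _ ≤ C * Real.exp (-1) ^ l := by gcongr
    _ = C * Real.exp (-l) := by rw [← Real.exp_nat_mul]; simp
    _ ≤ C * Real.exp (1 - y) := by gcongr; linarith
    _ = C * Real.exp 1 * Real.exp (-y) := by rw [sub_eq_add_neg, Real.exp_add]; ring

/-- **Watson's lemma**: on a sector of opening larger than `π`, a function that is flat of Gevrey
order `1` vanishes. A power map carries the right half-plane into the sector, in such a way that
the exponential decay in `1 / ‖t‖` becomes superexponential, and the Phragmén–Lindelöf principle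
applies. -/
theorem eqOn_zero_of_flat (hR : 0 < R) (hα : Real.pi < α) {h : ℂ → ℂ} {C K : ℝ} (hC : 0 < C)
    (hK : 0 < K) (hh : HasExpansion (sector θ α R) (fun _ => 0) h)
    (hG : GevreyOn (sector θ α R) C K h) : Set.EqOn h 0 (sector θ α R) := by
  have hS : IsOpen (sector θ α R) := isOpen_sector θ α R hR
  set κ : ℝ := α / Real.pi with hκ
  have hκ1 : 1 < κ := (one_lt_div Real.pi_pos).2 hα
  have hκ0 : 0 < κ := by linarith
  set b : ℝ := Real.log (R / 2) with hb
  -- the map `w ↦ (R / 2) e^{iθ} (w + 1)^{-κ}`; the shift keeps the half-plane away from `0`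
  set φ : ℂ → ℂ := fun w =>
    Complex.exp (-(κ : ℂ) * Complex.log (w + 1) + ((b : ℂ) + θ * Complex.I)) with hφ
  have hslit : ∀ w : ℂ, 0 ≤ w.re → w + 1 ∈ Complex.slitPlane := fun w hw => by
    left; simp only [Complex.add_re, Complex.one_re]; linarith
  have hnorm1 : ∀ w : ℂ, 0 ≤ w.re → 1 ≤ ‖w + 1‖ := fun w hw =>
    calc (1 : ℝ) ≤ (w + 1).re := by simpa using hw
      _ ≤ ‖w + 1‖ := Complex.re_le_norm _
  have hφS : ∀ w : ℂ, 0 ≤ w.re → φ w ∈ sector θ α R := by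
    intro w hw
    rw [sector_eq_image_exp _ _ _ hR]
    refine ⟨_, ⟨?_, ?_⟩, rfl⟩
    · have h1 : 0 ≤ Real.log ‖w + 1‖ := Real.log_nonneg (hnorm1 w hw)
      have h2 : b < Real.log R := Real.log_lt_log (by positivity) (by linarith)
      have h3 : 0 ≤ κ * Real.log ‖w + 1‖ := by positivity
      simp [Complex.log_re]
      linarith
    · have h1 : |(w + 1).arg| < Real.pi / 2 := by
        rw [Complex.abs_arg_lt_pi_div_two_iff]
        left; simp only [Complex.add_re, Complex.one_re]; linarith
      have h2 : κ * |(w + 1).arg| < α / 2 := by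
        calc κ * |(w + 1).arg| < κ * (Real.pi / 2) := by gcongr
          _ = α / 2 := by rw [hκ]; field_simp
      simpa [Complex.log_im, abs_mul, abs_of_pos hκ0] using h2
  have hφd : ∀ w : ℂ, 0 ≤ w.re → HasDerivAt φ (φ w * (-(κ : ℂ) * (w + 1)⁻¹)) w := by
    intro w hw
    have h1 : HasDerivAt (fun w : ℂ => Complex.log (w + 1)) ((w + 1)⁻¹) w := by
      simpa using ((hasDerivAt_id w).add_const 1).clog (hslit w hw)
    exact ((h1.const_mul (-(κ : ℂ))).add_const _).cexp
  have hgd : ∀ w : ℂ, 0 ≤ w.re → DifferentiableAt ℂ (h ∘ φ) w := fun w hw =>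
    (hh.diff.differentiableAt (hS.mem_nhds (hφS w hw))).comp w (hφd w hw).differentiableAt
  have hbdd : ∀ w : ℂ, 0 ≤ w.re → ‖(h ∘ φ) w‖ ≤ C := fun w hw => by
    simpa using hG 0 _ (hφS w hw)
  have hPL : Set.EqOn (h ∘ φ) 0 {w : ℂ | 0 ≤ w.re} := by
    refine PhragmenLindelof.eq_zero_on_right_half_plane_of_superexponential_decay ?_ ?_ ?_ ?_
    · refine DifferentiableOn.diffContOnCl fun w hw => ?_
      rw [Complex.closure_setOfPred_lt_re] at hw
      exact (hgd w hw).differentiableWithinAt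
    · refine ⟨1, by norm_num, 0, Asymptotics.IsBigO.of_bound C ?_⟩
      refine Filter.eventually_inf_principal.2 (Eventually.of_forall fun w hw => ?_)
      simpa using hbdd w (le_of_lt hw)
    · intro n
      set c : ℝ := (Real.exp 1 * (4 * K))⁻¹ / (R / 2) with hc
      have hc0 : 0 < c := by positivity
      have hlim : Tendsto (fun x : ℝ => x * (c * x ^ (κ - 1) - n)) atTop atTop :=
        tendsto_id.atTop_mul_atTop₀ (tendsto_atTop_add_const_right _ (-(n : ℝ))
          ((tendsto_rpow_atTop (sub_pos.2 hκ1)).const_mul_atTop hc0))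
      have hlim2 := (Real.tendsto_exp_neg_atTop_nhds_zero.comp hlim).const_mul (C * Real.exp 1)
      rw [mul_zero] at hlim2
      refine squeeze_zero' ?_ ?_ hlim2
      · exact Eventually.of_forall fun x => by positivity
      · filter_upwards [eventually_gt_atTop 0] with x hx
        have hx0 : 0 ≤ (x : ℂ).re := by simpa using hx.le
        have h1 := norm_le_exp_of_flat hR hC hK hh hG _ (hφS x hx0)
        have h2 : ‖φ x‖ = (R / 2) / (x + 1) ^ κ := by
          have h5 : ‖(x : ℂ) + 1‖ = x + 1 := by
            rw [← Complex.ofReal_one, ← Complex.ofReal_add, Complex.norm_real,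
              Real.norm_of_nonneg (by linarith)]
          rw [hφ, Complex.norm_exp, Real.rpow_def_of_pos (by linarith : 0 < x + 1)]
          simp only [Complex.add_re, Complex.mul_re, Complex.neg_re, Complex.ofReal_re,
            Complex.log_re, h5, Complex.neg_im, Complex.ofReal_im, Complex.I_re, Complex.I_im]
          rw [eq_div_iff (Real.exp_ne_zero _), ← Real.exp_add]
          ring_nf
          rw [hb, Real.exp_log (by positivity)]
          ring
        have h3 : x * x ^ (κ - 1) ≤ (x + 1) ^ κ := by
          rw [Real.rpow_sub_one hx.ne', mul_div_cancel₀ _ hx.ne']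
          exact Real.rpow_le_rpow hx.le (by linarith) hκ0.le
        calc Real.exp x ^ n * ‖(h ∘ φ) x‖
            ≤ Real.exp x ^ n * (C * Real.exp 1 *
                Real.exp (-((Real.exp 1 * (4 * K))⁻¹ / ‖φ x‖))) := by
              gcongr; exact h1
          _ = C * Real.exp 1 * Real.exp (n * x - c * (x + 1) ^ κ) := by
              rw [← Real.exp_nat_mul, h2, sub_eq_add_neg, Real.exp_add, hc]
              have h6 : (Real.exp 1 * (4 * K))⁻¹ / (R / 2 / (x + 1) ^ κ) =
                (Real.exp 1 * (4 * K))⁻¹ / (R / 2) * (x + 1) ^ κ := by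
                have : (x + 1) ^ κ ≠ 0 := (Real.rpow_pos_of_pos (by linarith) _).ne'
                field_simp
              rw [h6]
              ring
          _ ≤ C * Real.exp 1 * Real.exp (-(x * (c * x ^ (κ - 1) - n))) := by
              gcongr
              have := mul_le_mul_of_nonneg_left h3 hc0.le
              linarith
    · exact ⟨C, fun x => hbdd _ (by simp)⟩
  have h1re : (0 : ℝ) ≤ (1 : ℂ).re := by simp
  have hne : φ 1 * (-(κ : ℂ) * (1 + 1)⁻¹) ≠ 0 :=
    mul_ne_zero (Complex.exp_ne_zero _) (mul_ne_zero (neg_ne_zero.2 (by exact_mod_cast hκ0.ne'))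
      (by norm_num))
  have hev : ∀ᶠ w in 𝓝[≠] (1 : ℂ), h (φ w) = 0 := by
    have : ∀ᶠ w : ℂ in 𝓝 1, 0 < w.re :=
      (isOpen_lt continuous_const Complex.continuous_re).mem_nhds (by simp)
    filter_upwards [this.filter_mono nhdsWithin_le_nhds] with w hw
    exact hPL (le_of_lt hw : 0 ≤ w.re)
  -- `h` vanishes on an open subset of the sector, and the identity theorem applies
  have hfr : ∃ᶠ t in 𝓝[≠] (φ 1), h t = 0 :=
    ((hφd 1 h1re).tendsto_nhdsNE hne).frequently hev.frequently
  have han : AnalyticOnNhd ℂ h (sector θ α R) := hh.diff.analyticOnNhd hS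
  exact han.eqOn_zero_of_preconnected_of_frequently_eq_zero
    (isPreconnected_sector θ α R hR) (hφS 1 h1re) hfr

end

/-! ### Taylor coefficients in `z` of a function of `(t, z)` -/

section

variable {S : Set ℂ} {U : ℂ → ℝ → ℂ} {d : ℕ → ℝ → ℂ} {C K : ℝ}

theorem GevreyOn.congr (hS : IsOpen S) {v w : ℂ → ℂ} (h : GevreyOn S C K v)
    (hvw : Set.EqOn w v S) : GevreyOn S C K w := fun l t ht => by
  rw [iteratedDeriv_congr_of_isOpen hS hvw l ht]
  exact h l t ht

theorem GevreyOn.mono_set {S' : Set ℂ} {v : ℂ → ℂ} (h : GevreyOn S C K v) (hS : S' ⊆ S) :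
    GevreyOn S' C K v := fun l t ht => h l t (hS ht)

theorem GevreyOn.mono_const {C' K' : ℝ} {v : ℂ → ℂ} (h : GevreyOn S C K v) (hC : C ≤ C')
    (hC' : 0 ≤ C') (hK0 : 0 ≤ K) (hK : K ≤ K') : GevreyOn S C' K' v := fun l t ht =>
  (h l t ht).trans (by gcongr)

/-- The derivatives in `t` depend measurably on the parameter, as limits of difference
quotients. -/
theorem stronglyMeasurable_iteratedDeriv (hS : IsOpen S) (hU : ∀ t ∈ S, Continuous (U t))
    (hd : ∀ x, DifferentiableOn ℂ (fun t => U t x) S) (l : ℕ) :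
    ∀ t ∈ S, MeasureTheory.StronglyMeasurable fun x => iteratedDeriv l (fun s => U s x) t := by
  induction l with
  | zero => intro t ht; simpa using (hU t ht).stronglyMeasurable
  | succ l ih =>
    intro t ht
    obtain ⟨ε, hε, hb⟩ := Metric.isOpen_iff.1 hS t ht
    -- a sequence of increments that keeps `t + δ k` in `S` for all `k`
    set δ : ℕ → ℂ := fun k => ((ε / 2 * (1 / ((k : ℝ) + 1)) : ℝ) : ℂ) with hδ
    have hpos : ∀ k : ℕ, 0 < ε / 2 * (1 / ((k : ℝ) + 1)) := fun k => by positivity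
    have hmem : ∀ k, t + δ k ∈ S := fun k => by
      apply hb
      rw [Metric.mem_ball, dist_self_add_left, hδ, Complex.norm_real,
        Real.norm_of_nonneg (hpos k).le]
      have : 1 / ((k : ℝ) + 1) ≤ 1 := by
        rw [div_le_one (by positivity)]; linarith [(Nat.cast_nonneg k : (0 : ℝ) ≤ k)]
      nlinarith
    have hlim : Tendsto δ atTop (𝓝[≠] 0) := by
      refine tendsto_nhdsWithin_iff.2 ⟨?_, Eventually.of_forall fun k => ?_⟩
      · have h1 := (tendsto_one_div_add_atTop_nhds_zero_nat (𝕜 := ℝ)).const_mul (ε / 2)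
        have h2 := (Complex.continuous_ofReal.tendsto _).comp h1
        simpa [Function.comp_def, hδ] using h2
      · exact Complex.ofReal_ne_zero.2 (hpos k).ne'
    refine stronglyMeasurable_of_tendsto atTop (f := fun k x => (δ k)⁻¹ •
      (iteratedDeriv l (fun s => U s x) (t + δ k) - iteratedDeriv l (fun s => U s x) t))
      (fun k => (show MeasureTheory.StronglyMeasurable fun x =>
        iteratedDeriv l (fun s => U s x) (t + δ k) - iteratedDeriv l (fun s => U s x) t from
          (ih _ (hmem k)).sub (ih t ht)).const_smul ((δ k)⁻¹)) ?_
    rw [tendsto_pi_nhds]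
    intro x
    have h3 : HasDerivAt (iteratedDeriv l fun s => U s x)
        (iteratedDeriv (l + 1) (fun s => U s x) t) t := by
      rw [iteratedDeriv_succ]
      exact ((differentiableOn_iteratedDeriv hS (hd x) l).differentiableAt
        (hS.mem_nhds ht)).hasDerivAt
    exact (hasDerivAt_iff_tendsto_slope_zero.1 h3).comp hlim

variable {a b : ℝ} {k : ℝ → ℂ}

/-- Differentiation under the integral sign, all orders: the bounds are provided by the Gevrey
estimates, uniformly in the parameter. -/
theorem iteratedDeriv_integral (hS : IsOpen S) (hk : Continuous k)
    (hU : ∀ t ∈ S, Continuous (U t)) (hd : ∀ x, DifferentiableOn ℂ (fun t => U t x) S)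
    (hG : ∀ x, GevreyOn S C K fun t => U t x) (l : ℕ) : ∀ t ∈ S,
      iteratedDeriv l (fun t => ∫ x in a..b, k x * U t x) t =
        ∫ x in a..b, k x * iteratedDeriv l (fun t => U t x) t := by
  induction l with
  | zero => simp
  | succ l ih =>
    intro t ht
    have hm := stronglyMeasurable_iteratedDeriv hS hU hd
    have hbi : ∀ l : ℕ, IntervalIntegrable
        (fun x => ‖k x‖ * (C * K ^ l * (Nat.factorial (2 * l) : ℝ))) MeasureTheory.volume a b :=
      fun l => Continuous.intervalIntegrable (by fun_prop) _ _
    have hbd : ∀ l : ℕ, ∀ x, ∀ t ∈ S, ‖k x * iteratedDeriv l (fun t => U t x) t‖ ≤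
        ‖k x‖ * (C * K ^ l * (Nat.factorial (2 * l) : ℝ)) := fun l x t ht => by
      rw [norm_mul]
      exact mul_le_mul_of_nonneg_left (hG x l t ht) (norm_nonneg _)
    have key := intervalIntegral.hasDerivAt_integral_of_dominated_loc_of_deriv_le
      (μ := MeasureTheory.volume) (a := a) (b := b) (𝕜 := ℂ) (s := S) (x₀ := t)
      (F := fun t x => k x * iteratedDeriv l (fun t => U t x) t)
      (F' := fun t x => k x * iteratedDeriv (l + 1) (fun t => U t x) t)
      (bound := fun x => ‖k x‖ * (C * K ^ (l + 1) * (Nat.factorial (2 * (l + 1)) : ℝ)))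
      (hS.mem_nhds ht) ?_ ?_ ?_ ?_ (hbi (l + 1)) ?_
    · rw [iteratedDeriv_succ, ← key.2.deriv]
      exact Filter.EventuallyEq.deriv_eq (Set.EqOn.eventuallyEq_of_mem ih (hS.mem_nhds ht))
    · filter_upwards [hS.mem_nhds ht] with y hy
      exact (hk.stronglyMeasurable.mul (hm l y hy)).aestronglyMeasurable
    · refine (hbi l).mono_fun (hk.stronglyMeasurable.mul (hm l t ht)).aestronglyMeasurable ?_
      exact Eventually.of_forall fun x => (hbd l x t ht).trans (le_abs_self _)
    · exact (hk.stronglyMeasurable.mul (hm (l + 1) t ht)).aestronglyMeasurable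
    · exact Eventually.of_forall fun x _ t ht => hbd (l + 1) x t ht
    · refine Eventually.of_forall fun x _ t ht => ?_
      rw [iteratedDeriv_succ]
      exact ((differentiableOn_iteratedDeriv hS (hd x) l).differentiableAt
        (hS.mem_nhds ht)).hasDerivAt.const_mul _

theorem hasExpansion_integral (hS : IsOpen S) (hk : Continuous k)
    (hU : ∀ t ∈ S, Continuous (U t)) (hE : ∀ x, HasExpansion S (fun l => d l x) fun t => U t x)
    (hG : ∀ x, GevreyOn S C K fun t => U t x) :
    HasExpansion S (fun l => ∫ x in a..b, k x * d l x) (fun t => ∫ x in a..b, k x * U t x) := by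
  have hd : ∀ x, DifferentiableOn ℂ (fun t => U t x) S := fun x => (hE x).diff
  have hm := stronglyMeasurable_iteratedDeriv hS hU hd
  have hbi : ∀ l : ℕ, IntervalIntegrable
      (fun x => ‖k x‖ * (C * K ^ l * (Nat.factorial (2 * l) : ℝ))) MeasureTheory.volume a b :=
    fun l => Continuous.intervalIntegrable (by fun_prop) _ _
  have hbd : ∀ l : ℕ, ∀ x, ∀ t ∈ S, ‖k x * iteratedDeriv l (fun t => U t x) t‖ ≤
      ‖k x‖ * (C * K ^ l * (Nat.factorial (2 * l) : ℝ)) := fun l x t ht => by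
    rw [norm_mul]
    exact mul_le_mul_of_nonneg_left (hG x l t ht) (norm_nonneg _)
  refine ⟨fun t ht => ?_, fun l => ?_⟩
  · have key := intervalIntegral.hasDerivAt_integral_of_dominated_loc_of_deriv_le
      (μ := MeasureTheory.volume) (a := a) (b := b) (𝕜 := ℂ) (s := S) (x₀ := t)
      (F := fun t x => k x * U t x)
      (F' := fun t x => k x * iteratedDeriv 1 (fun t => U t x) t)
      (bound := fun x => ‖k x‖ * (C * K ^ 1 * (Nat.factorial (2 * 1) : ℝ)))
      (hS.mem_nhds ht) ?_ ?_ ?_ ?_ (hbi 1) ?_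
    · exact key.2.differentiableAt.differentiableWithinAt
    · filter_upwards [hS.mem_nhds ht] with y hy
      exact (hk.mul (hU y hy)).aestronglyMeasurable
    · exact (hk.mul (hU t ht)).intervalIntegrable _ _
    · exact (hk.stronglyMeasurable.mul (hm 1 t ht)).aestronglyMeasurable
    · exact Eventually.of_forall fun x _ t ht => hbd 1 x t ht
    · refine Eventually.of_forall fun x _ t ht => ?_
      rw [iteratedDeriv_one]
      exact ((hd x).differentiableAt (hS.mem_nhds ht)).hasDerivAt.const_mul _
  · have h1 : Tendsto (fun t => ∫ x in a..b, k x * iteratedDeriv l (fun t => U t x) t) (𝓝[S] 0)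
        (𝓝 (∫ x in a..b, k x * d l x)) := by
      refine intervalIntegral.tendsto_integral_filter_of_dominated_convergence _ ?_ ?_ (hbi l) ?_
      · filter_upwards [self_mem_nhdsWithin] with t ht
        exact (hk.stronglyMeasurable.mul (hm l t ht)).aestronglyMeasurable
      · filter_upwards [self_mem_nhdsWithin] with t ht
        exact Eventually.of_forall fun x _ => hbd l x t ht
      · exact Eventually.of_forall fun x _ => ((hE x).lim l).const_mul _
    refine h1.congr' ?_
    filter_upwards [self_mem_nhdsWithin] with t ht
    exact (iteratedDeriv_integral hS hk hU hd hG l t ht).symm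

end

section

variable {S : Set ℂ} {u : ℂ → ℂ → ℂ} {d : ℕ → ℂ → ℂ} {C K r : ℝ} {c : ℂ}

/-- Cauchy's formula for the Taylor coefficients, as an integral over `[0, 2π]` with the weight
split off. -/
theorem inv_factorial_mul_iteratedDeriv_eq_integral (hr : 0 < r) (n : ℕ) {g : ℂ → ℂ}
    (hg : DifferentiableOn ℂ g (Metric.closedBall c r)) :
    (n.factorial : ℂ)⁻¹ * iteratedDeriv n g c =
      ∫ x in (0 : ℝ)..2 * Real.pi, (2 * Real.pi * Complex.I)⁻¹ * deriv (circleMap c r) x *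
        (1 / (circleMap c r x - c) ^ (n + 1)) * g (circleMap c r x) := by
  have h := hg.circleIntegral_one_div_sub_center_pow_smul hr n
  rw [circleIntegral] at h
  simp only [smul_eq_mul, mul_assoc] at h ⊢
  rw [intervalIntegral.integral_const_mul, h]
  have := Complex.two_pi_I_ne_zero
  field_simp

/-- The Taylor coefficients in `z` of a function on `S × closedBall c r`, as functions of `t`:
Cauchy's integrals over the circle carry the expansion at the vertex and the Gevrey estimates over
to them. -/
theorem hasExpansion_taylorCoeff (hS : IsOpen S) (hr : 0 < r)
    (hu : ∀ t ∈ S, DifferentiableOn ℂ (u t) (Metric.closedBall c r))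
    (hd : ∀ l, DifferentiableOn ℂ (d l) (Metric.closedBall c r))
    (hE : ∀ z ∈ Metric.closedBall c r, HasExpansion S (fun l => d l z) fun t => u t z)
    (hG : ∀ z ∈ Metric.closedBall c r, GevreyOn S C K fun t => u t z) (n : ℕ) :
    HasExpansion S (fun l => (n.factorial : ℂ)⁻¹ * iteratedDeriv n (d l) c)
        (fun t => (n.factorial : ℂ)⁻¹ * iteratedDeriv n (u t) c) ∧
      GevreyOn S (C * (r⁻¹) ^ n) K fun t => (n.factorial : ℂ)⁻¹ * iteratedDeriv n (u t) c := by
  set k : ℝ → ℂ := fun x => (2 * Real.pi * Complex.I)⁻¹ * deriv (circleMap c r) x *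
        (1 / (circleMap c r x - c) ^ (n + 1)) with hk
  have hkn : ∀ x, ‖k x‖ = (2 * Real.pi)⁻¹ * (r⁻¹) ^ n := by
    intro x
    simp only [hk, norm_mul, norm_inv, norm_div, norm_pow, deriv_circleMap, circleMap_sub_center,
      norm_circleMap_zero, Complex.norm_I, norm_one, Complex.norm_real, Complex.norm_ofNat,
      abs_of_pos hr, Real.norm_of_nonneg Real.pi_pos.le]
    rw [pow_succ]
    field_simp
    rw [one_div, ← mul_pow, mul_inv_cancel₀ hr.ne', one_pow]
  have hkc : Continuous k := by
    refine (continuous_const.mul ?_).mul (continuous_const.div ?_ fun x => ?_)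
    · rw [funext (deriv_circleMap c r)]; fun_prop
    · exact ((continuous_circleMap c r).sub continuous_const).pow _
    · refine pow_ne_zero _ (sub_ne_zero.2 (circleMap_ne_center hr.ne'))
  have hmem : ∀ x, circleMap c r x ∈ Metric.closedBall c r := fun x =>
    circleMap_mem_closedBall c hr.le x
  have hUc : ∀ t ∈ S, Continuous fun x => u t (circleMap c r x) := fun t ht =>
    (hu t ht).continuousOn.comp_continuous (continuous_circleMap c r) hmem
  have h1 := hasExpansion_integral (a := 0) (b := 2 * Real.pi)
    (U := fun t x => u t (circleMap c r x)) (d := fun l x => d l (circleMap c r x))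
    hS hkc hUc (fun x => hE _ (hmem x))
    (fun x => hG _ (hmem x))
  have heq : Set.EqOn (fun t => (n.factorial : ℂ)⁻¹ * iteratedDeriv n (u t) c)
      (fun t => ∫ x in (0 : ℝ)..2 * Real.pi, k x * u t (circleMap c r x)) S := fun t ht =>
    inv_factorial_mul_iteratedDeriv_eq_integral hr n (hu t ht)
  refine ⟨(h1.congr hS heq).congr_coeff fun l =>
    (inv_factorial_mul_iteratedDeriv_eq_integral hr n (hd l)).symm, ?_⟩
  refine GevreyOn.congr hS (fun l t ht => ?_) heq
  rw [iteratedDeriv_integral (U := fun t x => u t (circleMap c r x)) hS hkc hUc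
    (fun x => (hE _ (hmem x)).diff) (fun x => hG _ (hmem x)) l t ht]
  have h2 := intervalIntegral.norm_integral_le_of_norm_le_const (a := (0 : ℝ)) (b := 2 * Real.pi)
    (f := fun x => k x * iteratedDeriv l (fun t => u t (circleMap c r x)) t)
    (C := (2 * Real.pi)⁻¹ * (r⁻¹) ^ n * (C * K ^ l * (Nat.factorial (2 * l) : ℝ))) (fun x _ => by
      rw [norm_mul, hkn]
      exact mul_le_mul_of_nonneg_left (hG _ (hmem x) l t ht) (by positivity))
  refine h2.trans (le_of_eq ?_)
  rw [sub_zero, abs_of_pos Real.two_pi_pos]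
  field_simp

end

/-! ### `1`-sums through their coefficients in `z` -/

section

variable {ρ θ α R r : ℝ} {uhat : PowerSeries (Hol ρ)} {u : ℂ → ℂ → ℂ}

theorem IsOneSumOn.differentiableOn_left (h : IsOneSumOn θ α R r uhat u) {z : ℂ}
    (hz : z ∈ Metric.ball (0 : ℂ) r) : DifferentiableOn ℂ (fun t => u t z) (sector θ α R) :=
  h.holomorphic.comp (f := fun t : ℂ => (t, z)) (by fun_prop) fun _ ht => ⟨ht, hz⟩

theorem IsOneSumOn.differentiableOn_right (h : IsOneSumOn θ α R r uhat u) {t : ℂ}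
    (ht : t ∈ sector θ α R) : DifferentiableOn ℂ (u t) (Metric.ball (0 : ℂ) r) :=
  h.holomorphic.comp (f := fun z : ℂ => (t, z)) (by fun_prop) fun _ hz => ⟨ht, hz⟩

theorem IsOneSumOn.hasExpansion (h : IsOneSumOn θ α R r uhat u) {T : Set ℂ}
    (hT : IsProperSubsector T (sector θ α R)) {z : ℂ} (hz : z ∈ Metric.ball (0 : ℂ) r) :
    HasExpansion T (fun l => (Nat.factorial l : ℂ) * fn (PowerSeries.coeff l uhat) z)
      fun t => u t z :=
  ⟨(h.differentiableOn_left hz).mono hT.subset, fun l => h.taylor T hT z hz l⟩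

/-- The Taylor coefficient of order `n` at `0` of a holomorphic function on `D_ρ`. -/
def taylorCoeff (n : ℕ) (g : Hol ρ) : ℂ := (n.factorial : ℂ)⁻¹ * iteratedDeriv n (fn g) 0

/-- The functions `v n` on `S` have the coefficients of `z ^ n` in the series `uhat` as Taylor
series at `0`, with Gevrey estimates of order `1` growing at most geometrically in `n`. By
`IsCoeffSum.isOneSumOn` and `IsOneSumOn.isCoeffSum`, this describes the `1`-sums of `uhat` through
their expansions in powers of `z`. -/
structure IsCoeffSum (S : Set ℂ) (uhat : PowerSeries (Hol ρ)) (C K M : ℝ) (v : ℕ → ℂ → ℂ) :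
    Prop where
  expansion : ∀ n, HasExpansion S
    (fun l => (Nat.factorial l : ℂ) * taylorCoeff n (PowerSeries.coeff l uhat)) (v n)
  gevrey : ∀ n, GevreyOn S (C * M ^ n) K (v n)

theorem iteratedDeriv_const_mul_fn (c : ℂ) (g : Hol ρ) (n : ℕ) :
    (n.factorial : ℂ)⁻¹ * iteratedDeriv n (fun z => c * fn g z) 0 = c * taylorCoeff n g := by
  have : iteratedDeriv n (fun z => c * fn g z) 0 = c * iteratedDeriv n (fn g) 0 :=
    iteratedDeriv_const_mul_field c (fn g)
  rw [this, taylorCoeff]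
  ring

theorem IsOneSumOn.isCoeffSum (h : IsOneSumOn θ α R r uhat u) {α₁ R₁ : ℝ}
    (hα₁ : Real.pi < α₁) (hα : α₁ < α) (hR₁ : 0 < R₁) (hR : R₁ < R) :
    ∃ C K M : ℝ, 0 < C ∧ 0 < K ∧ 0 < M ∧ IsCoeffSum (sector θ α₁ R₁) uhat C K M
      fun n t => (n.factorial : ℂ)⁻¹ * iteratedDeriv n (u t) 0 := by
  have hT : IsProperSubsector (sector θ α₁ R₁) (sector θ α R) :=
    isProperSubsector_sector (Real.pi_pos.trans hα₁) hα hR₁ hR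
  obtain ⟨C, K, hC, hK, hG⟩ := h.gevrey _ hT
  have hr := h.disc_pos
  have hsub : Metric.closedBall (0 : ℂ) (r / 2) ⊆ Metric.ball 0 r :=
    Metric.closedBall_subset_ball (by linarith)
  have hfn : ∀ l, DifferentiableOn ℂ (fun z => (Nat.factorial l : ℂ) *
      fn (PowerSeries.coeff l uhat) z) (Metric.closedBall 0 (r / 2)) := fun l =>
    ((differentiableOn_fn _).mono (hsub.trans (Metric.ball_subset_ball h.disc_le))).const_mul _
  have key := fun n => hasExpansion_taylorCoeff (isOpen_sector θ α₁ R₁ hR₁) (half_pos hr)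
    (fun t ht => (h.differentiableOn_right (hT.subset ht)).mono hsub) hfn
    (fun z hz => h.hasExpansion hT (hsub hz)) (fun z hz l t ht => hG l t ht z (hsub hz)) n
  exact ⟨C, K, (r / 2)⁻¹, hC, hK, by positivity,
    fun n => (key n).1.congr_coeff fun l => iteratedDeriv_const_mul_fn _ _ n,
    fun n => (key n).2⟩

section

variable {C K M : ℝ} {v : ℕ → ℂ → ℂ}

theorem norm_pow_mul_le (hM : 0 < M) {z : ℂ} (hz : ‖z‖ < 1 / (2 * M)) (n : ℕ) :
    M ^ n * ‖z‖ ^ n ≤ (1 / 2) ^ n := by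
  rw [← mul_pow]
  have : M * ‖z‖ ≤ M * (1 / (2 * M)) := by gcongr
  have h2 : M * (1 / (2 * M)) = 1 / 2 := by field_simp
  gcongr
  linarith

/-- On the disc of radius `1 / (2M)`, the series of all `t`-derivatives are dominated by a geometric
series. -/
theorem IsCoeffSum.norm_term_le (h : IsCoeffSum (sector θ α R) uhat C K M v) (hC : 0 < C)
    (hK : 0 < K) (hM : 0 < M) {z : ℂ} (hz : ‖z‖ < 1 / (2 * M)) (l n : ℕ) {t : ℂ}
    (ht : t ∈ sector θ α R) :
    ‖iteratedDeriv l (v n) t * z ^ n‖ ≤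
      C * K ^ l * (Nat.factorial (2 * l) : ℝ) * (1 / 2) ^ n := by
  rw [norm_mul, norm_pow]
  calc ‖iteratedDeriv l (v n) t‖ * ‖z‖ ^ n
      ≤ C * M ^ n * K ^ l * (Nat.factorial (2 * l) : ℝ) * ‖z‖ ^ n := by
        gcongr; exact h.gevrey n l t ht
    _ = C * K ^ l * (Nat.factorial (2 * l) : ℝ) * (M ^ n * ‖z‖ ^ n) := by ring
    _ ≤ _ := by gcongr; exact norm_pow_mul_le hM hz n

theorem IsCoeffSum.iteratedDeriv_tsum (h : IsCoeffSum (sector θ α R) uhat C K M v)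
    (hR : 0 < R) (hC : 0 < C) (hK : 0 < K) (hM : 0 < M) {z : ℂ} (hz : ‖z‖ < 1 / (2 * M)) (l : ℕ) :
    ∀ t ∈ sector θ α R, iteratedDeriv l (fun t => ∑' n, v n t * z ^ n) t =
      ∑' n, iteratedDeriv l (v n) t * z ^ n := by
  have hS := isOpen_sector θ α R hR
  induction l with
  | zero => simp
  | succ l ih =>
    intro t ht
    have hs : ∀ l : ℕ, Summable fun n : ℕ =>
        C * K ^ l * (Nat.factorial (2 * l) : ℝ) * (1 / 2) ^ n := fun l =>
      (summable_geometric_of_lt_one (by norm_num) (by norm_num)).mul_left _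
    have key := hasDerivAt_tsum_of_isPreconnected (hs (l + 1)) hS (isPreconnected_sector θ α R hR)
      (g := fun n t => iteratedDeriv l (v n) t * z ^ n)
      (g' := fun n t => iteratedDeriv (l + 1) (v n) t * z ^ n) (fun n y hy => by
        rw [iteratedDeriv_succ]
        exact ((differentiableOn_iteratedDeriv hS (h.expansion n).diff l).differentiableAt
          (hS.mem_nhds hy)).hasDerivAt.mul_const _)
      (fun n y hy => h.norm_term_le hC hK hM hz (l + 1) n hy) ht
      (Summable.of_norm_bounded (hs l) fun n => h.norm_term_le hC hK hM hz l n ht) ht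
    rw [iteratedDeriv_succ, ← key.deriv]
    exact Filter.EventuallyEq.deriv_eq (Set.EqOn.eventuallyEq_of_mem ih (hS.mem_nhds ht))

theorem IsCoeffSum.differentiableOn_tsum (h : IsCoeffSum (sector θ α R) uhat C K M v)
    (hR : 0 < R) (hC : 0 < C) (hK : 0 < K) (hM : 0 < M) :
    DifferentiableOn ℂ (fun p : ℂ × ℂ => ∑' n, v n p.1 * p.2 ^ n)
      (sector θ α R ×ˢ Metric.ball (0 : ℂ) (1 / (2 * M))) := by
  have hS := isOpen_sector θ α R hR
  have hr : 0 < 1 / (2 * M) := by positivity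
  intro p hp
  have hsum : Summable fun n : ℕ =>
      (2 * C * M) * ((n : ℝ) ^ 1 * (1 / 2) ^ n) + 2 * C * K * (1 / 2) ^ n :=
    ((summable_pow_mul_geometric_of_norm_lt_one 1 (by norm_num : ‖(1 / 2 : ℝ)‖ < 1)).mul_left
      _).add ((summable_geometric_of_lt_one (by norm_num) (by norm_num)).mul_left _)
  refine (hasFDerivAt_tsum_of_isPreconnected hsum (hS.prod Metric.isOpen_ball)
    ((isPreconnected_sector θ α R hR).prod (convex_ball _ _).isPreconnected)
    (f := fun n (p : ℂ × ℂ) => v n p.1 * p.2 ^ n)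
    (f' := fun n p => v n p.1 • (((n : ℂ) * p.2 ^ (n - 1)) • ContinuousLinearMap.snd ℂ ℂ ℂ) +
      p.2 ^ n • (deriv (v n) p.1 • ContinuousLinearMap.fst ℂ ℂ ℂ)) ?_ ?_ hp ?_
    hp).differentiableAt.differentiableWithinAt
  · rintro n ⟨t, z⟩ ⟨ht, hz⟩
    have h1 : HasFDerivAt (fun p : ℂ × ℂ => v n p.1)
        (deriv (v n) t • ContinuousLinearMap.fst ℂ ℂ ℂ) (t, z) :=
      (((h.expansion n).diff.differentiableAt (hS.mem_nhds ht)).hasDerivAt).comp_hasFDerivAt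
        (t, z) (ContinuousLinearMap.fst ℂ ℂ ℂ).hasFDerivAt
    have h2 : HasFDerivAt (fun p : ℂ × ℂ => p.2 ^ n)
        (((n : ℂ) * z ^ (n - 1)) • ContinuousLinearMap.snd ℂ ℂ ℂ) (t, z) :=
      (hasDerivAt_pow n z).comp_hasFDerivAt (t, z) (ContinuousLinearMap.snd ℂ ℂ ℂ).hasFDerivAt
    exact h1.mul h2
  · rintro n ⟨t, z⟩ ⟨ht, hz⟩
    have hz' : ‖z‖ < 1 / (2 * M) := by simpa using hz
    have hv0 : ‖v n t‖ ≤ C * M ^ n := by simpa using h.gevrey n 0 t ht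
    have hv1 := h.norm_term_le hC hK hM hz' 1 n ht
    rw [iteratedDeriv_one, norm_mul] at hv1
    have hfst := ContinuousLinearMap.norm_fst_le ℂ ℂ ℂ
    have hsnd := ContinuousLinearMap.norm_snd_le ℂ ℂ ℂ
    refine (norm_add_le _ _).trans (add_le_add ?_ ?_)
    · rw [norm_smul, norm_smul, norm_mul, norm_pow, Complex.norm_natCast, pow_one]
      rcases n with _ | n
      · simp
      · have h3 := norm_pow_mul_le hM hz' n
        rw [Nat.add_sub_cancel]
        calc ‖v (n + 1) t‖ * (((n + 1 : ℕ) : ℝ) * ‖z‖ ^ n * ‖ContinuousLinearMap.snd ℂ ℂ ℂ‖)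
            ≤ C * M ^ (n + 1) * (((n + 1 : ℕ) : ℝ) * ‖z‖ ^ n * 1) := by gcongr
          _ = C * M * ((n + 1 : ℕ) : ℝ) * (M ^ n * ‖z‖ ^ n) := by ring
          _ ≤ C * M * ((n + 1 : ℕ) : ℝ) * (1 / 2) ^ n := by gcongr
          _ = _ := by ring
    · rw [norm_smul, norm_smul, norm_pow]
      calc ‖z‖ ^ n * (‖deriv (v n) t‖ * ‖ContinuousLinearMap.fst ℂ ℂ ℂ‖)
          ≤ ‖z‖ ^ n * (‖deriv (v n) t‖ * 1) := by gcongr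
        _ = ‖deriv (v n) t‖ * ‖z‖ ^ n := by ring
        _ ≤ _ := by
          rw [norm_pow] at hv1
          refine hv1.trans (le_of_eq ?_)
          norm_num [Nat.factorial]
          ring
  · refine Summable.of_norm_bounded
      ((summable_geometric_of_lt_one (r := 1 / 2) (by norm_num) (by norm_num)).mul_left C)
      fun n => ?_
    have hz' : ‖p.2‖ < 1 / (2 * M) := by simpa using hp.2
    simpa using h.norm_term_le hC hK hM hz' 0 n hp.1

/-- The power series in `z` with the coefficients `v n` is a `1`-sum. -/
theorem IsCoeffSum.isOneSumOn (h : IsCoeffSum (sector θ α R) uhat C K M v) (hρ : 0 < ρ)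
    (hα : Real.pi < α) (hα2 : α ≤ 2 * Real.pi) (hR : 0 < R) (hC : 0 < C) (hK : 0 < K)
    (hM : 0 < M) :
    IsOneSumOn θ α R (min ρ (1 / (2 * M))) uhat fun t z => ∑' n, v n t * z ^ n := by
  have hz : ∀ z ∈ Metric.ball (0 : ℂ) (min ρ (1 / (2 * M))), ‖z‖ < 1 / (2 * M) := fun z hz =>
    (mem_ball_zero_iff.1 hz).trans_le (min_le_right _ _)
  have hgeo : HasSum (fun n : ℕ => (1 / 2 : ℝ) ^ n) 2 := hasSum_geometric_two
  refine ⟨hα, hα2, hR, lt_min hρ (by positivity), min_le_left _ _,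
    (h.differentiableOn_tsum hR hC hK hM).mono
      (Set.prod_mono_right (Metric.ball_subset_ball (min_le_right _ _))), ?_, ?_⟩
  · intro T hT z hzb l
    have hsum : ∑' n, (Nat.factorial l : ℂ) * taylorCoeff n (PowerSeries.coeff l uhat) * z ^ n =
        (Nat.factorial l : ℂ) * fn (PowerSeries.coeff l uhat) z := by
      have h1 := Complex.hasSum_taylorSeries_on_ball
        (differentiableOn_fn (PowerSeries.coeff l uhat))
        (Metric.ball_subset_ball (min_le_left _ _) hzb)
      rw [← (h1.mul_left (Nat.factorial l : ℂ)).tsum_eq]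
      refine tsum_congr fun n => ?_
      simp only [taylorCoeff, smul_eq_mul, sub_zero]
      ring
    rw [← hsum]
    have h2 : Tendsto (fun t => ∑' n, iteratedDeriv l (v n) t * z ^ n) (𝓝[T] 0) (𝓝 (∑' n,
        (Nat.factorial l : ℂ) * taylorCoeff n (PowerSeries.coeff l uhat) * z ^ n)) := by
      refine tendsto_tsum_of_dominated_convergence
        (hgeo.summable.mul_left (C * K ^ l * (Nat.factorial (2 * l) : ℝ)))
        (fun n => (((h.expansion n).mono hT.subset).lim l).mul_const _) ?_
      filter_upwards [self_mem_nhdsWithin] with t ht n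
      exact h.norm_term_le hC hK hM (hz z hzb) l n (hT.subset ht)
    refine h2.congr' ?_
    filter_upwards [self_mem_nhdsWithin] with t ht
    exact (h.iteratedDeriv_tsum hR hC hK hM (hz z hzb) l t (hT.subset ht)).symm
  · intro T hT
    refine ⟨2 * C, K, by positivity, hK, fun l t ht z hzb => ?_⟩
    rw [h.iteratedDeriv_tsum hR hC hK hM (hz z hzb) l t (hT.subset ht)]
    refine (tsum_of_norm_bounded (hgeo.mul_left _) fun n =>
      h.norm_term_le hC hK hM (hz z hzb) l n (hT.subset ht)).trans (le_of_eq ?_)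
    ring

end

end

/-! ### The heat equation for formal series -/

section

variable {ρ : ℝ}

theorem fn_apply (g : Hol ρ) {z : ℂ} (hz : z ∈ Metric.ball (0 : ℂ) ρ) : fn g z = g.1 ⟨z, hz⟩ :=
  extZero_apply _ hz

theorem fn_sub (f g : Hol ρ) {z : ℂ} (hz : z ∈ Metric.ball (0 : ℂ) ρ) :
    fn (f - g) z = fn f z - fn g z := by
  simp only [fn_apply _ hz]; rfl

theorem fn_mul (f g : Hol ρ) {z : ℂ} (hz : z ∈ Metric.ball (0 : ℂ) ρ) :
    fn (f * g) z = fn f z * fn g z := by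
  simp only [fn_apply _ hz]; rfl

theorem fn_smul (c : ℂ) (g : Hol ρ) {z : ℂ} (hz : z ∈ Metric.ball (0 : ℂ) ρ) :
    fn (c • g) z = c * fn g z := by
  simp only [fn_apply _ hz]; rfl

theorem fn_holDz (g : Hol ρ) {z : ℂ} (hz : z ∈ Metric.ball (0 : ℂ) ρ) :
    fn (holDz g) z = deriv (fn g) z := fn_apply _ hz

theorem fn_holDz_holDz (g : Hol ρ) {z : ℂ} (hz : z ∈ Metric.ball (0 : ℂ) ρ) :
    fn (holDz (holDz g)) z = iteratedDeriv 2 (fn g) z := by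
  rw [fn_holDz _ hz, iteratedDeriv_succ, iteratedDeriv_one]
  refine Filter.EventuallyEq.deriv_eq ?_
  filter_upwards [Metric.isOpen_ball.mem_nhds hz] with y hy using fn_holDz g hy

theorem contDiffAt_fn (hρ : 0 < ρ) (g : Hol ρ) (n : ℕ) : ContDiffAt ℂ n (fn g) 0 :=
  contDiffAt_of_differentiableOn Metric.isOpen_ball (differentiableOn_fn g)
    (Metric.mem_ball_self hρ) n

theorem taylorCoeff_sub (hρ : 0 < ρ) (f g : Hol ρ) (n : ℕ) :
    taylorCoeff n (f - g) = taylorCoeff n f - taylorCoeff n g := by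
  have h := iteratedDeriv_congr_of_isOpen Metric.isOpen_ball
    (fun z hz => fn_sub f g hz) n (Metric.mem_ball_self hρ)
  rw [taylorCoeff, h, iteratedDeriv_fun_sub (contDiffAt_fn hρ f n) (contDiffAt_fn hρ g n),
    taylorCoeff, taylorCoeff, mul_sub]

theorem taylorCoeff_smul (hρ : 0 < ρ) (c : ℂ) (g : Hol ρ) (n : ℕ) :
    taylorCoeff n (c • g) = c * taylorCoeff n g := by
  have h := iteratedDeriv_congr_of_isOpen Metric.isOpen_ball
    (fun z hz => fn_smul c g hz) n (Metric.mem_ball_self hρ)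
  rw [taylorCoeff, h, iteratedDeriv_const_mul_fn]

theorem taylorCoeff_mul (hρ : 0 < ρ) (f g : Hol ρ) (n : ℕ) :
    taylorCoeff n (f * g) =
      ∑ k ∈ Finset.range (n + 1), taylorCoeff (n - k) f * taylorCoeff k g := by
  have h := iteratedDeriv_congr_of_isOpen Metric.isOpen_ball
    (fun z hz => (fn_mul f g hz).trans (mul_comm _ _)) n (Metric.mem_ball_self hρ)
  rw [taylorCoeff, h, iteratedDeriv_fun_mul (contDiffAt_fn hρ g n) (contDiffAt_fn hρ f n),
    Finset.mul_sum]
  refine Finset.sum_congr rfl fun k hk => ?_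
  have hk' : k ≤ n := by simpa [Nat.lt_succ_iff] using hk
  rw [Nat.cast_choose ℂ hk', taylorCoeff, taylorCoeff]
  have : (n.factorial : ℂ) ≠ 0 := by exact_mod_cast n.factorial_ne_zero
  field_simp

theorem taylorCoeff_holDz (hρ : 0 < ρ) (g : Hol ρ) (n : ℕ) :
    taylorCoeff n (holDz g) = (n + 1) * taylorCoeff (n + 1) g := by
  have h := iteratedDeriv_congr_of_isOpen Metric.isOpen_ball
    (fun z hz => fn_holDz g hz) n (Metric.mem_ball_self hρ)
  rw [taylorCoeff, h, taylorCoeff, iteratedDeriv_succ', Nat.factorial_succ]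
  have h1 : (n.factorial : ℂ) ≠ 0 := by exact_mod_cast n.factorial_ne_zero
  have h2 : (n : ℂ) + 1 ≠ 0 := by exact_mod_cast n.succ_ne_zero
  push_cast
  field_simp

/-- The heat equation as a recursion for the coefficients of the powers of `t`. -/
theorem heatOp_eq_iff (a : Hol ρ) (u f : PowerSeries (Hol ρ)) :
    heatOp a u = f ↔ PowerSeries.coeff 0 u = PowerSeries.coeff 0 f ∧
      ∀ l, PowerSeries.coeff (l + 1) u - a * (((l : ℂ) + 1)⁻¹ •
        holDz (holDz (PowerSeries.coeff l u))) = PowerSeries.coeff (l + 1) f := by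
  have h0 : PowerSeries.coeff 0 (heatOp a u) = PowerSeries.coeff 0 u := by
    simp [heatOp, dtInv]
  have h1 : ∀ l, PowerSeries.coeff (l + 1) (heatOp a u) = PowerSeries.coeff (l + 1) u -
      a * (((l : ℂ) + 1)⁻¹ • holDz (holDz (PowerSeries.coeff l u))) := fun l => by
    rw [heatOp, map_sub, PowerSeries.coeff_C_mul]
    simp [dtInv, dz]
  constructor
  · rintro rfl
    exact ⟨h0.symm, fun l => (h1 l).symm⟩
  · rintro ⟨h2, h3⟩
    ext1 l
    rcases l with _ | l
    · rw [h0, h2]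
    · rw [h1, h3]

theorem existsUnique_heatOp_eq (a : Hol ρ) (f : PowerSeries (Hol ρ)) :
    ∃! u : PowerSeries (Hol ρ), heatOp a u = f := by
  refine ⟨PowerSeries.mk fun l => Nat.rec (PowerSeries.coeff 0 f) (fun l g =>
    PowerSeries.coeff (l + 1) f + a * (((l : ℂ) + 1)⁻¹ • holDz (holDz g))) l, ?_, ?_⟩
  · refine (heatOp_eq_iff _ _ _).2 ⟨by simp, fun l => ?_⟩
    simp only [PowerSeries.coeff_mk]
    exact add_sub_cancel_right _ _
  · intro u hu
    obtain ⟨h0, h1⟩ := (heatOp_eq_iff _ _ _).1 hu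
    ext1 l
    rw [PowerSeries.coeff_mk]
    induction l with
    | zero => exact h0
    | succ l ih => exact (sub_eq_iff_eq_add.1 (h1 l)).trans (by rw [ih])

variable {a : Hol ρ} {uhat fhat : PowerSeries (Hol ρ)}

/-- The heat equation, differentiated in `t`, at a point `z`. -/
theorem heatOp_apply (h : heatOp a uhat = fhat) (l : ℕ) {z : ℂ}
    (hz : z ∈ Metric.ball (0 : ℂ) ρ) :
    ((l + 1).factorial : ℂ) * fn (PowerSeries.coeff (l + 1) fhat) z =
      ((l + 1).factorial : ℂ) * fn (PowerSeries.coeff (l + 1) uhat) z -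
        fn a z * ((l.factorial : ℂ) * iteratedDeriv 2 (fn (PowerSeries.coeff l uhat)) z) := by
  rw [← ((heatOp_eq_iff _ _ _).1 h).2 l, fn_sub _ _ hz, fn_mul _ _ hz, fn_smul _ _ hz,
    fn_holDz_holDz _ hz, Nat.factorial_succ]
  have h2 : (l : ℂ) + 1 ≠ 0 := by exact_mod_cast l.succ_ne_zero
  push_cast
  field_simp

/-- The heat equation, differentiated in `t`, for the coefficients of the powers of `z`. -/
theorem heatOp_taylorCoeff (hρ : 0 < ρ) (h : heatOp a uhat = fhat) (l n : ℕ) :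
    ((l + 1).factorial : ℂ) * taylorCoeff n (PowerSeries.coeff (l + 1) fhat) =
      ((l + 1).factorial : ℂ) * taylorCoeff n (PowerSeries.coeff (l + 1) uhat) -
        ∑ k ∈ Finset.range (n + 1), taylorCoeff (n - k) a * (((k : ℂ) + 2) * (k + 1)) *
          ((l.factorial : ℂ) * taylorCoeff (k + 2) (PowerSeries.coeff l uhat)) := by
  rw [← ((heatOp_eq_iff _ _ _).1 h).2 l, taylorCoeff_sub hρ, taylorCoeff_mul hρ, mul_sub,
    Finset.mul_sum, Nat.factorial_succ]
  congr 1
  refine Finset.sum_congr rfl fun k _ => ?_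
  rw [taylorCoeff_smul hρ, taylorCoeff_holDz hρ, taylorCoeff_holDz hρ]
  have h2 : (l : ℂ) + 1 ≠ 0 := by exact_mod_cast l.succ_ne_zero
  push_cast
  field_simp
  ring

theorem coeff_zCoeff {n : ℕ} (hn : n.factorial = 1) (u : PowerSeries (Hol ρ)) (j : ℕ) :
    PowerSeries.coeff j (zCoeff n u) = taylorCoeff n (PowerSeries.coeff j u) := by
  simp [zCoeff, taylorCoeff, hn]

/-- Cauchy's estimates for the Taylor coefficients of a holomorphic function. -/
theorem exists_taylorCoeff_le (hρ : 0 < ρ) (a : Hol ρ) :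
    ∃ A s : ℝ, 0 < A ∧ 1 ≤ s ∧ ∀ n, ‖taylorCoeff n a‖ ≤ A * s ^ n := by
  have hd : DifferentiableOn ℂ (fn a) (Metric.closedBall 0 (ρ / 2)) :=
    (differentiableOn_fn a).mono (Metric.closedBall_subset_ball (by linarith))
  obtain ⟨B, hB⟩ := (isCompact_closedBall (0 : ℂ) (ρ / 2)).exists_bound_of_continuousOn
    hd.continuousOn
  have hB0 : 0 ≤ B := (norm_nonneg _).trans (hB 0 (by simp; positivity))
  refine ⟨B + 1, max 1 (ρ / 2)⁻¹, by positivity, le_max_left _ _, fun n => ?_⟩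
  have h1 := Complex.norm_iteratedDeriv_le_of_forall_mem_sphere_norm_le n (half_pos hρ)
    (hd.mono Metric.closure_ball_subset_closedBall).diffContOnCl
    fun z hz => hB z (Metric.sphere_subset_closedBall hz)
  have hf : (0 : ℝ) < n.factorial := by positivity
  rw [taylorCoeff, norm_mul, norm_inv, Complex.norm_natCast]
  calc (n.factorial : ℝ)⁻¹ * ‖iteratedDeriv n (fn a) 0‖
      ≤ (n.factorial : ℝ)⁻¹ * (n.factorial * B / (ρ / 2) ^ n) := by gcongr
    _ = B * ((ρ / 2)⁻¹) ^ n := by rw [inv_pow]; field_simp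
    _ ≤ (B + 1) * max 1 (ρ / 2)⁻¹ ^ n := by
        gcongr
        · linarith
        · exact le_max_right _ _

end

/-! ### The heat operator preserves summability -/

section

variable {S : Set ℂ} {C C' K : ℝ} {v w : ℂ → ℂ}

theorem GevreyOn.sub (hS : IsOpen S) (hv : GevreyOn S C K v) (hw : GevreyOn S C' K w)
    (hvd : DifferentiableOn ℂ v S) (hwd : DifferentiableOn ℂ w S) :
    GevreyOn S (C + C') K fun t => v t - w t := by
  intro l t ht
  rw [iteratedDeriv_fun_sub (contDiffAt_of_differentiableOn hS hvd ht l)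
    (contDiffAt_of_differentiableOn hS hwd ht l)]
  exact (norm_sub_le _ _).trans ((add_le_add (hv l t ht) (hw l t ht)).trans (le_of_eq (by ring)))

theorem GevreyOn.const_mul (hv : GevreyOn S C K v) (c : ℂ) :
    GevreyOn S (‖c‖ * C) K fun t => c * v t := by
  intro l t ht
  have : iteratedDeriv l (fun t => c * v t) t = c * iteratedDeriv l v t :=
    iteratedDeriv_const_mul_field c v
  rw [this, norm_mul, mul_assoc, mul_assoc, ← mul_assoc C]
  exact mul_le_mul_of_nonneg_left (hv l t ht) (norm_nonneg _)

theorem GevreyOn.sum (hS : IsOpen S) {ι : Type*} (s : Finset ι) {C : ι → ℝ} {v : ι → ℂ → ℂ}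
    (hv : ∀ i ∈ s, GevreyOn S (C i) K (v i)) (hd : ∀ i ∈ s, DifferentiableOn ℂ (v i) S) :
    GevreyOn S (∑ i ∈ s, C i) K fun t => ∑ i ∈ s, v i t := by
  intro l t ht
  rw [iteratedDeriv_fun_sum fun i hi => contDiffAt_of_differentiableOn hS (hd i hi) ht l,
    Finset.sum_mul, Finset.sum_mul]
  exact norm_sum_le_of_le s fun i hi => hv i hi l t ht

end

section

variable {ρ θ α R : ℝ} {a : Hol ρ} {uhat fhat : PowerSeries (Hol ρ)} {C K M : ℝ}
  {v : ℕ → ℂ → ℂ}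

theorem GevreyOn.primitive (hC : 0 ≤ C) (hK : 0 < K) (hR : 0 < R) {v V : ℂ → ℂ}
    (hv : GevreyOn (sector θ α R) C K v)
    (h0 : ∀ t ∈ sector θ α R, ‖V t‖ ≤ R * C)
    (h1 : ∀ l, Set.EqOn (iteratedDeriv (l + 1) V) (iteratedDeriv l v) (sector θ α R)) :
    GevreyOn (sector θ α R) (C * (R + K⁻¹)) K V := by
  rintro (_ | l) t ht
  · have h2 := h0 t ht
    have h3 : 0 ≤ C * K⁻¹ := by positivity
    simp only [iteratedDeriv_zero, pow_zero, mul_zero, Nat.factorial_zero, Nat.cast_one, mul_one]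
    linarith
  · rw [h1 l ht]
    have h2 : (Nat.factorial (2 * l) : ℝ) ≤ Nat.factorial (2 * (l + 1)) := by
      exact_mod_cast Nat.factorial_le (by omega)
    calc ‖iteratedDeriv l v t‖ ≤ C * K ^ l * (Nat.factorial (2 * l) : ℝ) := hv l t ht
      _ ≤ C * K ^ l * (Nat.factorial (2 * (l + 1)) : ℝ) := by gcongr
      _ = C * (0 + K⁻¹) * K ^ (l + 1) * (Nat.factorial (2 * (l + 1)) : ℝ) := by
        rw [pow_succ, zero_add]; field_simp
      _ ≤ C * (R + K⁻¹) * K ^ (l + 1) * (Nat.factorial (2 * (l + 1)) : ℝ) := by gcongr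

/-- If `uhat` is summable, so is its image by the heat operator. -/
theorem IsCoeffSum.heatOp (hρ : 0 < ρ) (hR : 0 < R) (hC : 0 < C) (hK : 0 < K) (hM : 1 ≤ M)
    (heq : heatOp a uhat = fhat) (h : IsCoeffSum (sector θ α R) uhat C K M v) :
    ∃ (C' M' : ℝ) (g : ℕ → ℂ → ℂ), 0 < C' ∧ 0 < M' ∧
      IsCoeffSum (sector θ α R) fhat C' K M' g := by
  have hS := isOpen_sector θ α R hR
  obtain ⟨A, s, hA, hs, has⟩ := exists_taylorCoeff_le hρ a
  have hprim := fun n => exists_primitive hR (h.expansion n) (B₀ := C * M ^ n)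
    (B₁ := C * M ^ n * K ^ 1 * (Nat.factorial (2 * 1) : ℝ))
    (fun t ht => by simpa using h.gevrey n 0 t ht)
    (fun t ht => by simpa only [iteratedDeriv_one] using h.gevrey n 1 t ht)
  choose P hPe hPd hPb using hprim
  have hPG : ∀ n, GevreyOn (sector θ α R) (C * M ^ n * (R + K⁻¹)) K (P n) := fun n =>
    GevreyOn.primitive (by positivity) hK hR (h.gevrey n) (hPb n) (hPd n)
  set B : ℝ := 2 * A * C * (R + K⁻¹) * M ^ 2 with hB
  have hB0 : 0 < B := by positivity
  refine ⟨C + B, 8 * s * M, fun n t => v n t - ∑ k ∈ Finset.range (n + 1),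
    (taylorCoeff (n - k) a * (((k : ℂ) + 2) * (k + 1))) * P (k + 2) t, by positivity,
    by positivity, fun n => ?_, fun n => ?_⟩
  · refine ((h.expansion n).sub hS
      (HasExpansion.sum hS _ fun k _ => (hPe (k + 2)).const_mul _)).congr_coeff ?_
    rintro (_ | l)
    · simp [((heatOp_eq_iff _ _ _).1 heq).1]
    · exact (heatOp_taylorCoeff hρ heq l n).symm
  · refine ((h.gevrey n).sub hS (GevreyOn.sum hS _ (fun k _ => (hPG (k + 2)).const_mul _)
      fun k _ => (hPe (k + 2)).diff.const_mul _) (h.expansion n).diff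
      (DifferentiableOn.fun_sum fun k _ => (hPe (k + 2)).diff.const_mul _)).mono_const
      ?_ (by positivity) hK.le le_rfl
    -- the terms are bounded by that of index `n`, up to the factor `(n + 1)^3 ≤ 8^n`
    have hterm : ∀ k ∈ Finset.range (n + 1),
        ‖taylorCoeff (n - k) a * (((k : ℂ) + 2) * (k + 1))‖ * (C * M ^ (k + 2) * (R + K⁻¹)) ≤
          A * s ^ n * ((n + 2) * (n + 1)) * (C * (M ^ n * M ^ 2) * (R + K⁻¹)) := by
      intro k hk
      have hkn : k ≤ n := by simpa [Nat.lt_succ_iff] using hk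
      have hkn' : (k : ℝ) ≤ n := by exact_mod_cast hkn
      have h1 : ‖((k : ℂ) + 2) * (k + 1)‖ = ((k : ℝ) + 2) * (k + 1) := by
        have : ((k : ℂ) + 2) * (k + 1) = (((k : ℝ) + 2) * (k + 1) : ℝ) := by push_cast; ring
        rw [this, Complex.norm_real, Real.norm_of_nonneg (by positivity)]
      have h2 : s ^ (n - k) ≤ s ^ n := pow_le_pow_right₀ hs (Nat.sub_le _ _)
      have h3 : M ^ k ≤ M ^ n := pow_le_pow_right₀ hM hkn
      rw [norm_mul, h1, pow_add]
      gcongr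
      exact (has _).trans (by gcongr)
    have h8 : ((n : ℝ) + 1) * ((n + 2) * (n + 1)) ≤ 2 * 8 ^ n := by
      have h1 : (n : ℝ) + 1 ≤ 2 ^ n := by
        have : n + 1 ≤ 2 ^ n := Nat.lt_two_pow_self
        exact_mod_cast this
      have h2 : (8 : ℝ) ^ n = 2 ^ n * (2 ^ n * 2 ^ n) := by
        rw [← mul_pow, ← mul_pow]; norm_num
      calc ((n : ℝ) + 1) * ((n + 2) * (n + 1)) ≤ (n + 1) * ((2 * (n + 1)) * (n + 1)) := by
            gcongr; linarith [(Nat.cast_nonneg n : (0 : ℝ) ≤ n)]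
        _ = 2 * ((n + 1) * ((n + 1) * (n + 1))) := by ring
        _ ≤ 2 * (2 ^ n * (2 ^ n * 2 ^ n)) := by gcongr
        _ = 2 * 8 ^ n := by rw [h2]
    have hsum := Finset.sum_le_sum hterm
    rw [Finset.sum_const, Finset.card_range, nsmul_eq_mul] at hsum
    have hsum2 : ((n + 1 : ℕ) : ℝ) * (A * s ^ n * ((n + 2) * (n + 1)) *
        (C * (M ^ n * M ^ 2) * (R + K⁻¹))) ≤ B * (8 * s * M) ^ n := by
      calc ((n + 1 : ℕ) : ℝ) * (A * s ^ n * ((n + 2) * (n + 1)) *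
            (C * (M ^ n * M ^ 2) * (R + K⁻¹)))
          = (((n : ℝ) + 1) * ((n + 2) * (n + 1))) *
              (A * s ^ n * (C * (M ^ n * M ^ 2) * (R + K⁻¹))) := by push_cast; ring
        _ ≤ (2 * 8 ^ n) * (A * s ^ n * (C * (M ^ n * M ^ 2) * (R + K⁻¹))) := by gcongr
        _ = B * (8 * s * M) ^ n := by rw [hB, mul_pow, mul_pow]; ring
    have h9 : C * M ^ n ≤ C * (8 * s * M) ^ n := by
      gcongr
      nlinarith
    linarith

end

/-! ### Summability of the solution -/

/-- The weight `(2l + 2n)! / (2n)!` that controls the `l`-th derivative of the coefficient of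
`z ^ n`: it absorbs the loss of one `t`-derivative at each step of the recursion in `n`, and for
fixed `l` it exceeds `(2l)!` only by a geometric factor in `n`. -/
def weight (l n : ℕ) : ℝ := (2 * l + 2 * n).factorial / (2 * n).factorial

theorem weight_pos (l n : ℕ) : 0 < weight l n := by unfold weight; positivity

theorem weight_succ_left (l n : ℕ) :
    weight (l + 1) n = weight l (n + 1) * ((2 * n + 2) * (2 * n + 1)) := by
  have h1 : (2 * (n + 1)).factorial = (2 * n + 2) * ((2 * n + 1) * (2 * n).factorial) := by
    rw [show 2 * (n + 1) = 2 * n + 1 + 1 by ring, Nat.factorial_succ, Nat.factorial_succ]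
  rw [weight, weight, h1, show 2 * (l + 1) + 2 * n = 2 * l + 2 * (n + 1) by ring]
  push_cast
  field_simp

theorem weight_le_succ_right (l n : ℕ) : weight l n ≤ weight l (n + 1) := by
  have h1 : (2 * (n + 1)).factorial = (2 * n + 2) * ((2 * n + 1) * (2 * n).factorial) := by
    rw [show 2 * (n + 1) = 2 * n + 1 + 1 by ring, Nat.factorial_succ, Nat.factorial_succ]
  have h2 : (2 * l + 2 * (n + 1)).factorial =
      (2 * l + 2 * n + 2) * ((2 * l + 2 * n + 1) * (2 * l + 2 * n).factorial) := by
    rw [show 2 * l + 2 * (n + 1) = 2 * l + 2 * n + 1 + 1 by ring, Nat.factorial_succ,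
      Nat.factorial_succ]
  rw [weight, weight, div_le_div_iff₀ (by positivity) (by positivity), h1, h2]
  push_cast
  have hl : (0 : ℝ) ≤ l := Nat.cast_nonneg l
  calc ((2 * l + 2 * n).factorial : ℝ) * ((2 * n + 2) * ((2 * n + 1) * (2 * n).factorial))
      ≤ ((2 * l + 2 * n).factorial : ℝ) *
        ((2 * l + 2 * n + 2) * ((2 * l + 2 * n + 1) * (2 * n).factorial)) := by
        gcongr <;> linarith
    _ = _ := by ring

theorem monotone_weight (l : ℕ) : Monotone (weight l) :=
  monotone_nat_of_le_succ (weight_le_succ_right l)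

theorem factorial_le_weight (l n : ℕ) : ((2 * l).factorial : ℝ) ≤ weight l n := by
  have h := monotone_weight l (Nat.zero_le n)
  simpa [weight] using h

theorem weight_le (l n : ℕ) : weight l n ≤ 4 ^ l * 4 ^ n * (2 * l).factorial := by
  rw [weight, div_le_iff₀ (by positivity)]
  refine (factorial_add_le (2 * l) (2 * n)).trans (le_of_eq ?_)
  rw [pow_add, pow_mul, pow_mul]
  norm_num
  ring

theorem sum_pow_sub_le {x : ℝ} (h0 : 0 ≤ x) (h1 : x ≤ 1 / 2) (n : ℕ) :
    ∑ k ∈ Finset.range n, x ^ (n - k) ≤ 2 * x := by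
  induction n with
  | zero => simpa using h0
  | succ n ih =>
    have h2 : ∑ k ∈ Finset.range n, x ^ (n + 1 - k) = x * ∑ k ∈ Finset.range n, x ^ (n - k) := by
      rw [Finset.mul_sum]
      refine Finset.sum_congr rfl fun k hk => ?_
      rw [Nat.succ_sub (Finset.mem_range.1 hk).le, pow_succ']
    rw [Finset.sum_range_succ, h2, Nat.add_sub_cancel_left, pow_one]
    nlinarith

/-- The majorant argument: a double sequence governed by the recursion of the heat equation,
in which the step `n → n + 2` costs one index `l`, stays below `C K^l M^n weight l n` for `M`
large. -/
theorem le_of_recursion {b G : ℕ → ℕ → ℝ} {C K M A s c : ℝ} {q : ℕ} (hq : q ≤ 1) (hC : 0 < C)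
    (hK : 0 < K) (hA : 0 < A) (hs : 1 ≤ s) (hc : 0 < c) (hM1 : 2 * s ≤ M)
    (hM2 : 12 * K + 2 * A * s ^ 2 ≤ c * M)
    (h0 : ∀ l, b 0 l ≤ C * K ^ l * (2 * l).factorial)
    (h1 : ∀ l, b 1 l ≤ C * K ^ l * (2 * l).factorial)
    (hG : ∀ n l, G n l ≤ C * K ^ l * (2 * l).factorial * M ^ n)
    (hrec : ∀ n l, c * ((n + 2) * (n + 1)) * b (n + 2) l ≤ b (n + q) (l + 1) + G (n + q) (l + 1) +
      ∑ k ∈ Finset.range n, A * s ^ (n + q - k) * ((k + 2) * (k + 1)) * b (k + 2) l) (n l : ℕ) :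
    b n l ≤ C * K ^ l * M ^ n * weight l n := by
  have hM : 1 ≤ M := by linarith
  have hM0 : 0 < M := by linarith
  have hle : ∀ n l, C * K ^ l * (2 * l).factorial * M ^ n ≤ C * K ^ l * M ^ n * weight l n := by
    intro n l
    have := factorial_le_weight l n
    calc C * K ^ l * (2 * l).factorial * M ^ n = C * K ^ l * M ^ n * (2 * l).factorial := by ring
      _ ≤ _ := by gcongr
  induction n using Nat.strong_induction_on generalizing l with
  | _ n ih =>
  rcases n with _ | _ | n
  · exact (h0 l).trans (by simpa using hle 0 l)
  · refine (h1 l).trans (le_trans ?_ (hle 1 l))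
    exact le_mul_of_one_le_right (by positivity) (by simpa using hM)
  set E : ℝ := C * K ^ l * M ^ (n + 2) * weight l (n + 2) with hE
  have hE0 : 0 < E := by have := weight_pos l (n + 2); positivity
  have hn0 : (0 : ℝ) ≤ n := Nat.cast_nonneg n
  -- the loss of a derivative is paid by the weight
  have hw : weight (l + 1) (n + q) ≤ 6 * ((n + 2) * (n + 1)) * weight l (n + 2) := by
    rw [weight_succ_left]
    have hwp := weight_pos l (n + 2)
    interval_cases q
    · have h3 := weight_le_succ_right l (n + 1)
      calc weight l (n + 0 + 1) * ((2 * ((n + 0 : ℕ) : ℝ) + 2) * (2 * ((n + 0 : ℕ) : ℝ) + 1))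
          ≤ weight l (n + 2) * ((2 * ((n + 0 : ℕ) : ℝ) + 2) * (2 * ((n + 0 : ℕ) : ℝ) + 1)) := by
            gcongr
        _ ≤ weight l (n + 2) * (6 * ((n + 2) * (n + 1))) :=
            mul_le_mul_of_nonneg_left (by push_cast; nlinarith) hwp.le
        _ = _ := by ring
    · rw [mul_comm (6 * (((n : ℝ) + 2) * (n + 1)))]
      exact mul_le_mul_of_nonneg_left (by push_cast; nlinarith) hwp.le
  have hT : C * K ^ (l + 1) * M ^ (n + q) * weight (l + 1) (n + q) ≤
      6 * ((n + 2) * (n + 1)) * (K / M) * E := by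
    calc C * K ^ (l + 1) * M ^ (n + q) * weight (l + 1) (n + q)
        ≤ C * K ^ (l + 1) * M ^ (n + 1) * (6 * ((n + 2) * (n + 1)) * weight l (n + 2)) := by
          have := (weight_pos (l + 1) (n + q)).le
          gcongr
      _ = 6 * ((n + 2) * (n + 1)) * (K / M) * E := by
          rw [hE, pow_succ K, pow_succ M (n + 1)]
          field_simp
  have hT1 := (ih (n + q) (by omega) (l + 1)).trans hT
  have hT2 := ((hG (n + q) (l + 1)).trans (hle _ _)).trans hT
  have hT3 : ∑ k ∈ Finset.range n, A * s ^ (n + q - k) * ((k + 2) * (k + 1)) * b (k + 2) l ≤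
      2 * A * s ^ 2 / M * ((n + 2) * (n + 1)) * E := by
    have hterm : ∀ k ∈ Finset.range n,
        A * s ^ (n + q - k) * ((k + 2) * (k + 1)) * b (k + 2) l ≤
          A * s * ((n + 2) * (n + 1)) * E * (s / M) ^ (n - k) := by
      intro k hk
      have hkn : k < n := Finset.mem_range.1 hk
      have hkn' : (k : ℝ) ≤ n := by exact_mod_cast hkn.le
      have h3 : s ^ (n + q - k) ≤ s * s ^ (n - k) := by
        rw [← pow_succ']
        exact pow_le_pow_right₀ hs (by omega)
      have h4 : b (k + 2) l ≤ C * K ^ l * M ^ (k + 2) * weight l (n + 2) :=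
        (ih (k + 2) (by omega) l).trans (by
          have := monotone_weight l (show k + 2 ≤ n + 2 by omega)
          gcongr)
      have hwp := weight_pos l (n + 2)
      calc A * s ^ (n + q - k) * ((k + 2) * (k + 1)) * b (k + 2) l
          ≤ A * s ^ (n + q - k) * ((k + 2) * (k + 1)) *
              (C * K ^ l * M ^ (k + 2) * weight l (n + 2)) := by gcongr
        _ ≤ A * (s * s ^ (n - k)) * ((n + 2) * (n + 1)) *
              (C * K ^ l * M ^ (k + 2) * weight l (n + 2)) := by gcongr
        _ = A * s * ((n + 2) * (n + 1)) * E * (s / M) ^ (n - k) := by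
            have h5 : M ^ (n + 2) = M ^ (k + 2) * M ^ (n - k) := by
              rw [← pow_add]; congr 1; omega
            rw [hE, h5, div_pow]
            field_simp
    have hx : s / M ≤ 1 / 2 := by rw [div_le_div_iff₀ hM0 (by norm_num)]; linarith
    refine (Finset.sum_le_sum hterm).trans ?_
    rw [← Finset.mul_sum]
    calc A * s * ((n + 2) * (n + 1)) * E * ∑ k ∈ Finset.range n, (s / M) ^ (n - k)
        ≤ A * s * ((n + 2) * (n + 1)) * E * (2 * (s / M)) := by
          gcongr
          exact sum_pow_sub_le (by positivity) hx n
      _ = _ := by field_simp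
  have hfin : c * ((n + 2) * (n + 1)) * b (n + 2) l ≤ c * ((n + 2) * (n + 1)) * E := by
    calc c * ((n + 2) * (n + 1)) * b (n + 2) l
        ≤ 6 * ((n + 2) * (n + 1)) * (K / M) * E + 6 * ((n + 2) * (n + 1)) * (K / M) * E +
            2 * A * s ^ 2 / M * ((n + 2) * (n + 1)) * E :=
          (hrec n l).trans (add_le_add (add_le_add hT1 hT2) hT3)
      _ = (12 * K + 2 * A * s ^ 2) / M * (((n + 2) * (n + 1)) * E) := by ring
      _ ≤ c * (((n + 2) * (n + 1)) * E) := by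
          gcongr
          rwa [div_le_iff₀ hM0]
      _ = _ := by ring
  exact le_of_mul_le_mul_left hfin (by positivity)

/-- The coefficients in `z` of the solution of the heat equation with the coefficients `u₀`, `u₁`
of `z ^ 0` and `z ^ 1`, for a conductivity `∑ a k z^k` vanishing exactly to the order `q ≤ 1` and
a right-hand side `∑ g n z^n`. For `q = 1` the function `u₀` does not enter the recursion. -/
def solveCoeff (a : ℕ → ℂ) (q : Fin 2) (u₀ u₁ : ℂ → ℂ) (g : ℕ → ℂ → ℂ) : ℕ → ℂ → ℂ
  | 0 => u₀
  | 1 => u₁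
  | n + 2 => fun t => (a q * (((n : ℂ) + 2) * (n + 1)))⁻¹ *
      ((deriv (solveCoeff a q u₀ u₁ g (n + q)) t - deriv (g (n + q)) t) -
        ∑ k : Fin n, a (n + q - k) * ((((k : ℕ) : ℂ) + 2) * ((k : ℕ) + 1)) *
          solveCoeff a q u₀ u₁ g (k + 2) t)
  termination_by n => n
  decreasing_by all_goals omega

section

variable {ρ θ α R : ℝ} {a : Hol ρ} {uhat fhat : PowerSeries (Hol ρ)}

/-- The recursion of `solveCoeff` holds for the formal coefficients. -/
theorem taylorCoeff_recursion (hρ : 0 < ρ) (heq : heatOp a uhat = fhat) (q : Fin 2)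
    (ha : taylorCoeff q a ≠ 0) (ha0 : q = 1 → taylorCoeff 0 a = 0) (l n : ℕ) :
    (l.factorial : ℂ) * taylorCoeff (n + 2) (PowerSeries.coeff l uhat) =
      (taylorCoeff q a * (((n : ℂ) + 2) * (n + 1)))⁻¹ *
        ((((l + 1).factorial : ℂ) * taylorCoeff (n + q) (PowerSeries.coeff (l + 1) uhat) -
          ((l + 1).factorial : ℂ) * taylorCoeff (n + q) (PowerSeries.coeff (l + 1) fhat)) -
        ∑ k : Fin n, taylorCoeff (n + q - k) a * ((((k : ℕ) : ℂ) + 2) * ((k : ℕ) + 1)) *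
          ((l.factorial : ℂ) * taylorCoeff (k + 2) (PowerSeries.coeff l uhat))) := by
  have hsum : ∑ k ∈ Finset.range (n + q + 1), taylorCoeff (n + q - k) a *
        (((k : ℂ) + 2) * (k + 1)) * ((l.factorial : ℂ) *
          taylorCoeff (k + 2) (PowerSeries.coeff l uhat)) =
      ∑ k : Fin n, taylorCoeff (n + q - k) a * ((((k : ℕ) : ℂ) + 2) * ((k : ℕ) + 1)) *
          ((l.factorial : ℂ) * taylorCoeff (k + 2) (PowerSeries.coeff l uhat)) +
        taylorCoeff q a * (((n : ℂ) + 2) * (n + 1)) *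
          ((l.factorial : ℂ) * taylorCoeff (n + 2) (PowerSeries.coeff l uhat)) := by
    rw [Fin.sum_univ_eq_sum_range (fun k => taylorCoeff (n + q - k) a *
        (((k : ℂ) + 2) * (k + 1)) * ((l.factorial : ℂ) *
          taylorCoeff (k + 2) (PowerSeries.coeff l uhat)))]
    rcases (show q = 0 ∨ q = 1 by omega) with rfl | rfl
    · simp [Finset.sum_range_succ]
    · simp [Finset.sum_range_succ, ha0 rfl]
  rw [heatOp_taylorCoeff hρ heq l (n + q), hsum]
  have h1 : ((n : ℂ) + 2) ≠ 0 := by exact_mod_cast (n + 1).succ_ne_zero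
  have h2 : ((n : ℂ) + 1) ≠ 0 := by exact_mod_cast n.succ_ne_zero
  rw [eq_inv_mul_iff_mul_eq₀ (mul_ne_zero ha (mul_ne_zero h1 h2))]
  ring

variable {C K M : ℝ} {g : ℕ → ℂ → ℂ} {u₀ u₁ : ℂ → ℂ}

theorem hasExpansion_solveCoeff {S : Set ℂ} (hS : IsOpen S) (hρ : 0 < ρ)
    (heq : heatOp a uhat = fhat) (q : Fin 2)
    (ha : taylorCoeff q a ≠ 0) (ha0 : q = 1 → taylorCoeff 0 a = 0)
    (h0 : HasExpansion S (fun l => (l.factorial : ℂ) *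
      taylorCoeff 0 (PowerSeries.coeff l uhat)) u₀)
    (h1 : HasExpansion S (fun l => (l.factorial : ℂ) *
      taylorCoeff 1 (PowerSeries.coeff l uhat)) u₁)
    (hg : ∀ n, HasExpansion S (fun l => (l.factorial : ℂ) *
      taylorCoeff n (PowerSeries.coeff l fhat)) (g n)) (n : ℕ) :
    HasExpansion S (fun l => (l.factorial : ℂ) * taylorCoeff n (PowerSeries.coeff l uhat))
      (solveCoeff (fun k => taylorCoeff k a) q u₀ u₁ g n) := by
  induction n using Nat.strong_induction_on with
  | _ n ih =>
  rcases n with _ | _ | n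
  · rw [solveCoeff]; exact h0
  · rw [solveCoeff]; exact h1
  rw [solveCoeff]
  have h2 := ((((ih (n + q) (by omega)).deriv hS).sub hS ((hg (n + q)).deriv hS)).sub hS
    (HasExpansion.sum hS Finset.univ fun (k : Fin n) _ => (ih (k + 2) (by omega)).const_mul
      (taylorCoeff (n + q - k) a * ((((k : ℕ) : ℂ) + 2) * ((k : ℕ) + 1))))).const_mul
      (taylorCoeff q a * (((n : ℂ) + 2) * (n + 1)))⁻¹
  exact h2.congr_coeff fun l => (taylorCoeff_recursion hρ heq q ha ha0 l n).symm

theorem iteratedDeriv_solveCoeff {S : Set ℂ} (hS : IsOpen S) {b : ℕ → ℂ} (q : Fin 2)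
    (hu : ∀ n, DifferentiableOn ℂ (solveCoeff b q u₀ u₁ g n) S)
    (hg : ∀ n, DifferentiableOn ℂ (g n) S) (n l : ℕ) {t : ℂ} (ht : t ∈ S) :
    iteratedDeriv l (solveCoeff b q u₀ u₁ g (n + 2)) t =
      (b q * (((n : ℂ) + 2) * (n + 1)))⁻¹ *
        ((iteratedDeriv (l + 1) (solveCoeff b q u₀ u₁ g (n + q)) t -
          iteratedDeriv (l + 1) (g (n + q)) t) -
        ∑ k : Fin n, b (n + q - k) * ((((k : ℕ) : ℂ) + 2) * ((k : ℕ) + 1)) *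
          iteratedDeriv l (solveCoeff b q u₀ u₁ g (k + 2)) t) := by
  have hc : ∀ {v : ℂ → ℂ}, DifferentiableOn ℂ v S → ContDiffAt ℂ l v t := fun hv =>
    contDiffAt_of_differentiableOn hS hv ht l
  have hd1 : DifferentiableOn ℂ (deriv (solveCoeff b q u₀ u₁ g (n + q))) S := (hu _).deriv hS
  have hd2 : DifferentiableOn ℂ (deriv (g (n + q))) S := (hg _).deriv hS
  have hd3 : ∀ k ∈ (Finset.univ : Finset (Fin n)), ContDiffAt ℂ l (fun t => b (n + q - k) *
      ((((k : ℕ) : ℂ) + 2) * ((k : ℕ) + 1)) * solveCoeff b q u₀ u₁ g (k + 2) t) t :=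
    fun k _ => hc ((hu _).const_mul _)
  have e0 : solveCoeff b q u₀ u₁ g (n + 2) = fun t => (b q * (((n : ℂ) + 2) * (n + 1)))⁻¹ *
      ((deriv (solveCoeff b q u₀ u₁ g (n + q)) t - deriv (g (n + q)) t) -
        ∑ k : Fin n, b (n + q - k) * ((((k : ℕ) : ℂ) + 2) * ((k : ℕ) + 1)) *
          solveCoeff b q u₀ u₁ g (k + 2) t) := by
    funext t; rw [solveCoeff]
  rw [e0, iteratedDeriv_succ', iteratedDeriv_succ']
  have e1 := fun (c : ℂ) (v : ℂ → ℂ) => iteratedDeriv_const_mul_field (n := l) (x := t) c v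
  rw [e1, iteratedDeriv_fun_sub ((hc hd1).sub (hc hd2)) (ContDiffAt.sum hd3),
    iteratedDeriv_fun_sub (hc hd1) (hc hd2), iteratedDeriv_fun_sum hd3]
  simp only [e1]

/-- If the coefficients of `z ^ 0` and `z ^ 1` in `uhat` and the series `D uhat` are summable, so
is `uhat`. -/
theorem exists_isCoeffSum_of_heatOp (hρ : 0 < ρ) (hR : 0 < R) (hC : 0 < C) (hK : 0 < K)
    (heq : heatOp a uhat = fhat) (q : Fin 2)
    (ha : taylorCoeff q a ≠ 0) (ha0 : q = 1 → taylorCoeff 0 a = 0)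
    (h0 : HasExpansion (sector θ α R) (fun l => (l.factorial : ℂ) *
      taylorCoeff 0 (PowerSeries.coeff l uhat)) u₀)
    (h0G : GevreyOn (sector θ α R) C K u₀)
    (h1 : HasExpansion (sector θ α R) (fun l => (l.factorial : ℂ) *
      taylorCoeff 1 (PowerSeries.coeff l uhat)) u₁)
    (h1G : GevreyOn (sector θ α R) C K u₁)
    (hg : IsCoeffSum (sector θ α R) fhat C K M g) (hM : 0 < M) :
    ∃ (K' M' : ℝ) (v : ℕ → ℂ → ℂ), 0 < K' ∧ 0 < M' ∧
      IsCoeffSum (sector θ α R) uhat C K' M' v := by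
  have hS := isOpen_sector θ α R hR
  obtain ⟨A, s, hA, hs, has⟩ := exists_taylorCoeff_le hρ a
  set c : ℝ := ‖taylorCoeff q a‖ with hc
  have hc0 : 0 < c := norm_pos_iff.2 ha
  set v := solveCoeff (fun k => taylorCoeff k a) q u₀ u₁ g with hv
  have hve := hasExpansion_solveCoeff hS hρ heq q ha ha0 h0 h1 hg.expansion
  -- `N` is the geometric rate required by the majorant argument
  set N : ℝ := max M (max (2 * s) ((12 * K + 2 * A * s ^ 2) / c)) with hN
  have hMN : M ≤ N := le_max_left _ _
  have hN1 : 2 * s ≤ N := (le_max_left _ _).trans (le_max_right _ _)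
  have hN2 : 12 * K + 2 * A * s ^ 2 ≤ c * N := by
    rw [mul_comm c, ← div_le_iff₀ hc0]
    exact (le_max_right _ _).trans (le_max_right _ _)
  have hN0 : 0 < N := hM.trans_le hMN
  refine ⟨4 * K, 4 * N, v, by positivity, by positivity, hve, fun n l t ht => ?_⟩
  have hrec := le_of_recursion (b := fun n l => ‖iteratedDeriv l (v n) t‖)
    (G := fun n l => ‖iteratedDeriv l (g n) t‖) (q := q) (by omega) hC hK hA hs hc0 hN1 hN2
    (fun l => by rw [hv, solveCoeff]; exact h0G l t ht)
    (fun l => by rw [hv, solveCoeff]; exact h1G l t ht)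
    (fun n l => (hg.gevrey n l t ht).trans (by
      calc C * M ^ n * K ^ l * (2 * l).factorial ≤ C * N ^ n * K ^ l * (2 * l).factorial := by
            gcongr
        _ = _ := by ring))
    (fun n l => by
      have h2 := iteratedDeriv_solveCoeff hS q (fun n => (hve n).diff)
        (fun n => (hg.expansion n).diff) n l ht
      have h3 : ∀ m : ℕ, ‖((m : ℂ) + 2) * (m + 1)‖ = ((m : ℝ) + 2) * (m + 1) := fun m => by
        have : ((m : ℂ) + 2) * (m + 1) = (((m : ℝ) + 2) * (m + 1) : ℝ) := by push_cast; ring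
        rw [this, Complex.norm_real, Real.norm_of_nonneg (by positivity)]
      have h4 : ‖iteratedDeriv l (v (n + 2)) t‖ = (c * (((n : ℝ) + 2) * (n + 1)))⁻¹ *
          ‖(iteratedDeriv (l + 1) (v (n + q)) t - iteratedDeriv (l + 1) (g (n + q)) t) -
            ∑ k : Fin n, taylorCoeff (n + q - k) a * ((((k : ℕ) : ℂ) + 2) * ((k : ℕ) + 1)) *
              iteratedDeriv l (v (k + 2)) t‖ := by
        rw [hv, h2, norm_mul, norm_inv, norm_mul, h3]
      rw [h4, mul_inv_cancel_left₀ (by positivity)]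
      refine (norm_sub_le _ _).trans (add_le_add (norm_sub_le _ _) ?_)
      rw [← Fin.sum_univ_eq_sum_range (fun k => A * s ^ (n + q - k) * (((k : ℝ) + 2) * (k + 1)) *
        ‖iteratedDeriv l (v (k + 2)) t‖)]
      refine norm_sum_le_of_le _ fun k _ => ?_
      rw [norm_mul, norm_mul, h3]
      gcongr
      exact has _) n l
  refine hrec.trans ?_
  calc C * K ^ l * N ^ n * weight l n
      ≤ C * K ^ l * N ^ n * (4 ^ l * 4 ^ n * (2 * l).factorial) := by
        gcongr; exact weight_le l n
    _ = _ := by rw [mul_pow, mul_pow]; ring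

end

/-! ### Summability of `û` and the equation for the `1`-sums -/

section

variable {θ α R C K : ℝ} {w : ℂ → ℂ}

theorem GevreyOn.deriv {S : Set ℂ} (hC : 0 ≤ C) (hK : 0 ≤ K) (hw : GevreyOn S C K w) :
    GevreyOn S (8 * C * K) (4 * K) (deriv w) := by
  intro l t ht
  rw [← iteratedDeriv_succ']
  have h1 : ((2 * (l + 1)).factorial : ℝ) ≤ 8 * 4 ^ l * (2 * l).factorial := by
    have h2 := factorial_add_le (2 * l) 2
    rw [pow_add, pow_mul, show 2 * l + 2 = 2 * (l + 1) by ring] at h2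
    norm_num [Nat.factorial] at h2 ⊢
    linarith
  calc ‖iteratedDeriv (l + 1) w t‖ ≤ C * K ^ (l + 1) * ((2 * (l + 1)).factorial : ℝ) :=
        hw (l + 1) t ht
    _ ≤ C * K ^ (l + 1) * (8 * 4 ^ l * (2 * l).factorial) := by gcongr
    _ = _ := by rw [mul_pow]; ring

theorem HasExpansion.isScalarOneSumOn {uhat : PowerSeries ℂ}
    (hw : HasExpansion (sector θ α R) (fun l => (l.factorial : ℂ) * PowerSeries.coeff l uhat) w)
    (hG : GevreyOn (sector θ α R) C K w) (hα : Real.pi < α) (hα2 : α ≤ 2 * Real.pi) (hR : 0 < R)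
    (hC : 0 < C) (hK : 0 < K) : IsScalarOneSumOn θ α R uhat w :=
  ⟨hα, hα2, hR, hw.diff, fun _ hT l => (hw.mono hT.subset).lim l,
    fun _ hT => ⟨C, K, hC, hK, hG.mono_set hT.subset⟩⟩

theorem IsScalarOneSumOn.hasExpansion {uhat : PowerSeries ℂ} (h : IsScalarOneSumOn θ α R uhat w)
    {T : Set ℂ} (hT : IsProperSubsector T (sector θ α R)) :
    HasExpansion T (fun l => (l.factorial : ℂ) * PowerSeries.coeff l uhat) w :=
  ⟨h.holomorphic.mono hT.subset, h.taylor T hT⟩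

end

section

variable {ρ θ α R : ℝ} {a : Hol ρ} {uhat fhat : PowerSeries (Hol ρ)}

theorem IsCoeffSum.mono {S : Set ℂ} {C K M C' K' M' : ℝ} {v : ℕ → ℂ → ℂ}
    (h : IsCoeffSum S uhat C K M v) (hC0 : 0 ≤ C) (hK0 : 0 ≤ K) (hM0 : 0 ≤ M) (hC : C ≤ C')
    (hK : K ≤ K') (hM : M ≤ M') : IsCoeffSum S uhat C' K' M' v :=
  have hC' : 0 ≤ C' := hC0.trans hC
  ⟨h.expansion, fun n => (h.gevrey n).mono_const (by gcongr)
    (mul_nonneg hC' (pow_nonneg (hM0.trans hM) n)) hK0 hK⟩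

theorem IsOneSummable.zCoeff_and_heatOp (hρ : 0 < ρ) (heq : heatOp a uhat = fhat)
    (h : IsOneSummable θ uhat) :
    IsScalarOneSummable θ (zCoeff 0 uhat) ∧ IsScalarOneSummable θ (zCoeff 1 uhat) ∧
      IsOneSummable θ fhat := by
  obtain ⟨α, R, r, u, hu⟩ := h
  obtain ⟨α₁, hπ, hα⟩ := exists_between hu.opening_gt
  obtain ⟨R₁, hR₁, hR⟩ := exists_between hu.radius_pos
  have hα2 : α₁ ≤ 2 * Real.pi := hα.le.trans hu.opening_le
  obtain ⟨C, K, M, hC, hK, hM, hv⟩ := hu.isCoeffSum hπ hα hR₁ hR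
  have hz : ∀ n : ℕ, n.factorial = 1 → IsScalarOneSummable θ (zCoeff n uhat) := fun n hn =>
    ⟨α₁, R₁, _, ((hv.expansion n).congr_coeff fun l => by
      rw [coeff_zCoeff hn]).isScalarOneSumOn (hv.gevrey n) hπ hα2 hR₁ (by positivity) hK⟩
  refine ⟨hz 0 rfl, hz 1 rfl, ?_⟩
  obtain ⟨C', M', g, hC', hM', hg⟩ := (hv.mono hC.le hK.le hM.le le_rfl le_rfl
    (le_max_left M 1)).heatOp hρ hR₁ hC hK (le_max_right M 1) heq
  exact ⟨α₁, R₁, _, _, hg.isOneSumOn hρ hπ hα2 hR₁ hC' hK hM'⟩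

theorem isOneSummable_of_heatOp (hρ : 0 < ρ) (heq : heatOp a uhat = fhat)
    (ha : fn a 0 ≠ 0 ∨ (fn a 0 = 0 ∧ deriv (fn a) 0 ≠ 0))
    (h0 : IsScalarOneSummable θ (zCoeff 0 uhat)) (h1 : IsScalarOneSummable θ (zCoeff 1 uhat))
    (hf : IsOneSummable θ fhat) : IsOneSummable θ uhat := by
  obtain ⟨α0, R0, u₀, h0⟩ := h0
  obtain ⟨α1, R1, u₁, h1⟩ := h1
  obtain ⟨α2, R2, r, f, hf⟩ := hf
  obtain ⟨α, hπ, hα⟩ := exists_between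
    (lt_min h0.opening_gt (lt_min h1.opening_gt hf.opening_gt))
  obtain ⟨R, hR0, hR⟩ := exists_between
    (lt_min h0.radius_pos (lt_min h1.radius_pos hf.radius_pos))
  simp only [lt_min_iff] at hα hR
  have hα0 : 0 < α := Real.pi_pos.trans hπ
  have hT0 := isProperSubsector_sector (θ := θ) hα0 hα.1 hR0 hR.1
  have hT1 := isProperSubsector_sector (θ := θ) hα0 hα.2.1 hR0 hR.2.1
  obtain ⟨C0, K0, hC0, hK0, hG0⟩ := h0.gevrey _ hT0
  obtain ⟨C1, K1, hC1, hK1, hG1⟩ := h1.gevrey _ hT1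
  obtain ⟨C2, K2, M, hC2, hK2, hM, hg⟩ := hf.isCoeffSum hπ hα.2.2 hR0 hR.2.2
  obtain ⟨q, hq, hq0⟩ : ∃ q : Fin 2, taylorCoeff q a ≠ 0 ∧ (q = 1 → taylorCoeff 0 a = 0) := by
    rcases ha with ha | ⟨ha, ha'⟩
    · exact ⟨0, by simpa [taylorCoeff] using ha, by simp⟩
    · exact ⟨1, by simpa [taylorCoeff] using ha', fun _ => by simpa [taylorCoeff] using ha⟩
  have hC : 0 < C0 + C1 + C2 := by positivity
  obtain ⟨K', M', v, hK', hM', hv⟩ := exists_isCoeffSum_of_heatOp (C := C0 + C1 + C2)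
    (K := K0 + K1 + K2) hρ hR0 hC (by positivity) heq q hq hq0
    ((h0.hasExpansion hT0).congr_coeff fun l => by rw [coeff_zCoeff rfl])
    (GevreyOn.mono_const hG0 (by linarith) hC.le hK0.le (by linarith))
    ((h1.hasExpansion hT1).congr_coeff fun l => by rw [coeff_zCoeff rfl])
    (GevreyOn.mono_const hG1 (by linarith) hC.le hK1.le (by linarith))
    (hg.mono hC2.le hK2.le hM.le (by linarith) (by linarith) le_rfl) hM
  exact ⟨α, R, _, _, hv.isOneSumOn hρ hπ (hα.1.le.trans h0.opening_le) hR0 hC hK' hM'⟩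

/-- The `1`-sums satisfy the heat equation: its derivative in `t` holds since both sides have the
same Taylor series at the vertex, by Watson's lemma, and it is then integrated along a segment. -/
theorem IsOneSumOn.satisfiesHeatAt (heq : heatOp a uhat = fhat) {r α' R' r' : ℝ}
    {u f : ℂ → ℂ → ℂ} (hu : IsOneSumOn θ α R r uhat u) (hf : IsOneSumOn θ α' R' r' fhat f)
    {t z : ℂ} (ht : t ∈ sector θ α R) (ht' : t ∈ sector θ α' R')
    (hz : z ∈ Metric.ball (0 : ℂ) r) (hz' : z ∈ Metric.ball (0 : ℂ) r') :
    SatisfiesHeatAt a u f t z := by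
  obtain ⟨α₁, R₁, hπ, hα, hα', hR₁, hR, hR', htT⟩ := exists_common_subsector hu.opening_gt
    hu.opening_le hf.opening_gt hf.opening_le ht ht'
  have hα₁ : 0 < α₁ := Real.pi_pos.trans hπ
  have hT := isProperSubsector_sector (θ := θ) hα₁ hα hR₁ hR
  have hT' := isProperSubsector_sector (θ := θ) hα₁ hα' hR₁ hR'
  set T := sector θ α₁ R₁ with hTdef
  have hTo : IsOpen T := isOpen_sector θ α₁ R₁ hR₁
  obtain ⟨C, K, hC, hK, hG⟩ := hu.gevrey _ hT
  obtain ⟨C', K', hC', hK', hG'⟩ := hf.gevrey _ hT'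
  have hzρ : z ∈ Metric.ball (0 : ℂ) ρ := Metric.ball_subset_ball hu.disc_le hz
  -- `∂_z² u(·, z)` is a Cauchy integral over a circle centred at `z`
  obtain ⟨δ, hδ, hsub⟩ := Metric.nhds_basis_closedBall.mem_iff.1 (Metric.isOpen_ball.mem_nhds hz)
  have key := hasExpansion_taylorCoeff hTo hδ
    (fun t ht => (hu.differentiableOn_right (hT.subset ht)).mono hsub)
    (fun l => ((differentiableOn_fn (PowerSeries.coeff l uhat)).mono
      (hsub.trans (Metric.ball_subset_ball hu.disc_le))).const_mul (Nat.factorial l : ℂ))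
    (fun z hz => hu.hasExpansion hT (hsub hz)) (fun z hz l t ht => hG l t ht z (hsub hz)) 2
  set w : ℂ → ℂ := fun t => iteratedDeriv 2 (u t) z with hw
  have hwE : HasExpansion T (fun l => (l.factorial : ℂ) *
      iteratedDeriv 2 (fn (PowerSeries.coeff l uhat)) z) w := by
    refine ((key.1.const_mul 2).congr hTo fun t _ => ?_).congr_coeff fun l => ?_
    · simp [hw]
    · have : iteratedDeriv 2 (fun z => (l.factorial : ℂ) * fn (PowerSeries.coeff l uhat) z) z =
        (l.factorial : ℂ) * iteratedDeriv 2 (fn (PowerSeries.coeff l uhat)) z :=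
        iteratedDeriv_const_mul_field _ _
      simp [this]
  obtain ⟨C₂, hC₂, hwG⟩ : ∃ C₂, 0 < C₂ ∧ GevreyOn T C₂ K w :=
    ⟨‖(2 : ℂ)‖ * (C * (δ⁻¹) ^ 2), by rw [Complex.norm_ofNat]; positivity,
      (key.2.const_mul 2).congr hTo fun t _ => by simp [hw]⟩
  have huE := hu.hasExpansion hT hz
  have hfE := hf.hasExpansion hT' hz'
  have hGu : GevreyOn T C K fun t => u t z := fun l t ht => hG l t ht z hz
  have hGf : GevreyOn T C' K' fun t => f t z := fun l t ht => hG' l t ht z hz'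
  have hH := (((huE.deriv hTo).sub hTo (hwE.const_mul (fn a z))).sub hTo
    (hfE.deriv hTo)).congr_coeff (e := fun _ => 0) fun l => by
      rw [heatOp_apply heq l hzρ, sub_self]
  -- Watson's lemma for `∂_t u - a ∂_z² u - ∂_t f`
  have hK0 : K ≤ 4 * (K + K') := by linarith
  have hHG := (((hGu.deriv hC.le hK.le).mono_const le_rfl (by positivity) (by positivity)
    (by linarith : 4 * K ≤ 4 * (K + K'))).sub hTo ((hwG.const_mul (fn a z)).mono_const le_rfl
      (by positivity) hK.le hK0) (huE.deriv hTo).diff (hwE.const_mul _).diff).sub hTo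
    ((hGf.deriv hC'.le hK'.le).mono_const le_rfl (by positivity) (by positivity)
      (by linarith : 4 * K' ≤ 4 * (K + K')))
    ((huE.deriv hTo).sub hTo (hwE.const_mul _)).diff (hfE.deriv hTo).diff
  have hzero := eqOn_zero_of_flat hR₁ hπ (by positivity) (by positivity) hH hHG
  have hwb : ∀ t ∈ T, ‖w t‖ ≤ C₂ := fun t ht => by simpa using hwG 0 t ht
  refine ⟨intervalIntegrable_segment (g := fun x : ℝ => w ((x : ℂ) * t))
    (continuousOn_segment hwE.diff.continuousOn htT)
    fun x hx => hwb _ (smul_mem_sector htT hx.1 hx.2), ?_⟩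
  have hV := (integral_segment (V := fun t => u t z - f t z) (v := fun t => fn a z * w t)
    (V₀ := 0) (B := ‖fn a z‖ * C₂) (fun t ht => ?_) (hwE.diff.continuousOn.const_mul _)
    (fun t ht => ?_) ?_ htT).2
  · rw [intervalIntegral.integral_const_mul, sub_zero] at hV
    change u t z - fn a z * (t * ∫ x in (0 : ℝ)..1, w ((x : ℂ) * t)) = f t z
    linear_combination -hV
  · have h1 := (huE.diff.differentiableAt (hTo.mem_nhds ht)).hasDerivAt
    have h2 := (hfE.diff.differentiableAt (hTo.mem_nhds ht)).hasDerivAt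
    refine (h1.sub h2).congr_deriv ?_
    have h3 := hzero ht
    simp only [Pi.zero_apply] at h3
    linear_combination h3
  · rw [norm_mul]
    exact mul_le_mul_of_nonneg_left (hwb t ht) (norm_nonneg _)
  · have h1 := (huE.lim 0).sub (hfE.lim 0)
    simpa [((heatOp_eq_iff _ _ _).1 heq).1] using h1

end

end HeatSum

end

theorem mainTheorem1 (ρ : ℝ) (hρ : 0 < ρ) (θ : ℝ) (a : HeatSum.Hol ρ)
    (ha : HeatSum.fn a 0 ≠ 0 ∨ (HeatSum.fn a 0 = 0 ∧ deriv (HeatSum.fn a) 0 ≠ 0))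
    (fhat : PowerSeries (HeatSum.Hol ρ)) :
    (∃! uhat : PowerSeries (HeatSum.Hol ρ), HeatSum.heatOp a uhat = fhat) ∧
    ∀ uhat : PowerSeries (HeatSum.Hol ρ), HeatSum.heatOp a uhat = fhat →
      (HeatSum.IsOneSummable θ uhat ↔
        HeatSum.IsScalarOneSummable θ (HeatSum.zCoeff 0 uhat) ∧
        HeatSum.IsScalarOneSummable θ (HeatSum.zCoeff 1 uhat) ∧
        HeatSum.IsOneSummable θ fhat) ∧
      ∀ (α R r : ℝ) (u : ℂ → ℂ → ℂ), HeatSum.IsOneSumOn θ α R r uhat u →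
        ∀ (α' R' r' : ℝ) (f : ℂ → ℂ → ℂ), HeatSum.IsOneSumOn θ α' R' r' fhat f →
          ∀ t ∈ HeatSum.sector θ α R ∩ HeatSum.sector θ α' R',
          ∀ z ∈ Metric.ball (0 : ℂ) r ∩ Metric.ball (0 : ℂ) r',
            HeatSum.SatisfiesHeatAt a u f t z := by
  refine ⟨HeatSum.existsUnique_heatOp_eq a fhat, fun uhat heq =>
    ⟨⟨fun h => h.zCoeff_and_heatOp hρ heq,
    fun h => HeatSum.isOneSummable_of_heatOp hρ heq ha h.1 h.2.1 h.2.2⟩, ?_⟩⟩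
  intro α R r u hu α' R' r' f hf t ht z hz
  exact hu.satisfiesHeatAt heq hf ht.1 ht.2 hz.1 hz.2
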